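/- **Setting.** Let $K$ be a field equipped with a product formula: a family $(|\cdot|_v)_{v\in M_K}$ of absolute values and real weights $n_v>0$ such that all but finitely many $|\cdot|_v$ are non-archimedean, those which are not are induced by embeddings $K\hookrightarrow\mathbb C$, and for every $x\in K^*$ one has $|x|_v=1$ for all but finitely many $v$ and $\prod_v |x|_v^{n_v}=1$. Let $\overline K$ be an algebraic closure of $K$, $K_v$ the completion of $K$ at $v$, $\mathbb C_v$ the completion of an algebraic closure of $K_v$ (with the unique extension of $|\cdot|_v$), and fix $K$-embeddings $\overline K\hookrightarrow\mathbb C_v$. The absolute logarithmic height of $\alpha\in\overline K$ is $$h(\alpha)=\frac1{\#S}\sum_{z\in S}\sum_{v\in M_K} n_v\log^+|z|_v,$$ where $S$ is the set of conjugates of $\alpha$ over $K$. Assume the Northcott property: for all $d$ and $B$ there are only finitely many $\alpha\in\overline K$ of degree at most $d$ over $K$ with $h(\alpha)\le B$. (Main examples: number fields, and function fields of curves over finite fields.) For $\phi\in K[z]$ of degree $d\ge 2$ let $\hat h_\phi(\alpha)=\lim_{n\to\infty} d^{-n}h(\phi^n(\alpha))$. A point $\alpha\in\overline K$ is preperiodic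 for $\phi$ if $\{\phi^n(\alpha):n\ge 0\}$ is finite. For a non-archimedean $v\in M_K$, the polynomial $\phi=\sum_{i\le d}a_iz^i$ (with $a_d\ne0$) has good reduction at $v$ if $|a_i|_v\le1$ for all $i$ and $|a_d|_v=1$. An element $\alpha\in\overline K$ is totally $v$-adic of type $(e,f)$ if for every $K$-embedding $K(\alpha)\hookrightarrow\mathbb C_v$ the image is contained in a finite extension of $K_v$ whose ramification index is at most $e$ and whose residue degree is at most $f$. **Theorem.** Let $v\in M_K$ be a non-archimedean place whose completion $K_v$ is locally compact (for a nontrivial $v$: $|K^*|_v$ is discrete and the residue field of $v$ is finite; this is automatic for the nontrivial places of number fields and of function fields of curves over finite fields). Let $e,f$ be positive integers. There is a constant $C>0$, depending on $K$ (with its product formula), $v$, $e$, $f$ but not on $\phi$, such that for every $\phi\in K[z]$ of degree at least $2$ with good reduction at $v$: 1. $\hat h_\phi(\alpha)\ge C$ for all but finitely many of the $\alpha\in\overline K$ that are totally $v$-adic of type $(e,f)$ (the exceptional set may depend on $\phi$); 2. only finitely many preperiodic points $\alpha\in\overline K$ of $\phi$ are totally $v$-adic of type $(e,f)$. -/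

import Mathlib

open Polynomial Filter
open scoped NNReal

noncomputable section

/-- A product formula structure on a field `K`: a family of absolute values `|·|_v` and weights
`n_v > 0` such that all but finitely many `|·|_v` are ultrametric, those which are not are induced
by embeddings into `ℂ`, every `x ≠ 0` satisfies `|x|_v = 1` for all but finitely many `v`, and
`∏_v |x|_v ^ n_v = 1`. -/
structure ProductFormula (K : Type*) [Field K] where
  /-- The index set `M_K`. -/
  Place : Type*
  absVal : Place → AbsoluteValue K ℝ
  weight : Place → ℝ
  weight_pos : ∀ v, 0 < weight v
  finite_not_isNonarchimedean : {v | ¬ IsNonarchimedean (absVal v)}.Finite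
  exists_embedding : ∀ v, ¬ IsNonarchimedean (absVal v) → ∃ σ : K →+* ℂ, ∀ x, absVal v x = ‖σ x‖
  finite_ne_one : ∀ x : K, x ≠ 0 → {v | absVal v x ≠ 1}.Finite
  prod_eq_one : ∀ x : K, x ≠ 0 → ∏ᶠ v, absVal v x ^ weight v = 1

namespace ProductFormula

variable {K : Type*} [Field K] (M : ProductFormula K)

/-- The completion `K_v`. -/
abbrev Compl (v : M.Place) : Type _ := (M.absVal v).Completion

/-- An algebraic closure of `K_v`. -/
abbrev ComplBar (v : M.Place) : Type _ := AlgebraicClosure (M.Compl v)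

/-- The unique extension of the absolute value of `K_v` to the algebraic closure of `K_v`:
`|z| = |N(z)| ^ (1 / [K_v(z) : K_v])`, where `N` is the norm of `K_v(z)` over `K_v`; up to sign,
`N(z)` is the constant coefficient of the minimal polynomial of `z`. -/
def extAbs (v : M.Place) (z : M.ComplBar v) : ℝ :=
  ‖(minpoly (M.Compl v) z).coeff 0‖ ^ (1 / ((minpoly (M.Compl v) z).natDegree : ℝ))

/-- The distinguished `K`-embedding of `K̄` into the algebraic closure of `K_v`. -/
def embed (v : M.Place) : AlgebraicClosure K →ₐ[K] M.ComplBar v :=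
  haveI : Module.IsTorsionFree K (M.ComplBar v) :=
    Module.isTorsionFree_iff_algebraMap_injective.mpr (algebraMap K (M.ComplBar v)).injective
  IsAlgClosed.lift

/-- The set of conjugates over `K` of `α`, i.e. the smallest Galois-stable set containing `α`. -/
def conjugates (α : AlgebraicClosure K) : Finset (AlgebraicClosure K) :=
  (minpoly K α).rootSet_finite (AlgebraicClosure K) |>.toFinset

/-- The absolute logarithmic height
`h(α) = (1 / #S) * ∑_{z ∈ S} ∑_v n_v log⁺ |z|_v`, where `S` is the set of conjugates of `α`. -/
def height (α : AlgebraicClosure K) : ℝ :=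
  (1 / ((conjugates α).card : ℝ)) *
    ∑ z ∈ conjugates α, ∑ᶠ v, M.weight v * Real.posLog (M.extAbs v (M.embed v z))

/-- The Northcott finiteness property. -/
def Northcott : Prop :=
  ∀ (d : ℕ) (B : ℝ), {α : AlgebraicClosure K | (minpoly K α).natDegree ≤ d ∧ M.height α ≤ B}.Finite

/-- The self-map of `K̄` defined by the polynomial `φ`. -/
def polyMap (φ : K[X]) (z : AlgebraicClosure K) : AlgebraicClosure K := aeval z φ

/-- The canonical height `lim_n h(φ^n(α)) / d ^ n`, where `d = deg φ`. -/
def canonicalHeight (φ : K[X]) (α : AlgebraicClosure K) : ℝ :=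
  limUnder atTop fun n : ℕ => M.height ((polyMap φ)^[n] α) / (φ.natDegree : ℝ) ^ n

/-- The forward orbit of `α` under `φ` is finite. -/
def IsPreperiodic (φ : K[X]) (α : AlgebraicClosure K) : Prop :=
  (Set.range fun n : ℕ => (polyMap φ)^[n] α).Finite

/-- Good reduction at a non-archimedean `v`: `v`-integral coefficients, unit leading coefficient. -/
def GoodReduction (v : M.Place) (φ : K[X]) : Prop :=
  (∀ i, M.absVal v (φ.coeff i) ≤ 1) ∧ M.absVal v φ.leadingCoeff = 1

end ProductFormula

section Extensions

variable (k : Type*) {F : Type*} [Field k] [Field F] [Algebra k F] (w : Valuation F ℝ≥0)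

/-- The ramification index of `F / k` with respect to a rank one valuation `w` of `F`: the index
of the value group of `k` in that of `F`. -/
def ramificationIndex : ℕ :=
  (Units.map (w.comap (algebraMap k F) : k →* ℝ≥0)).range.relIndex (Units.map (w : F →* ℝ≥0)).range

instance restrict_hasExtension : (w.comap (algebraMap k F)).HasExtension w :=
  ⟨Valuation.IsEquiv.refl⟩

/-- The residue degree of `F / k` with respect to `w`: the degree of the extension of residue
fields. -/
def residueDegree : ℕ :=
  Module.finrank (IsLocalRing.ResidueField (w.comap (algebraMap k F)).valuationSubring)
    (IsLocalRing.ResidueField w.valuationSubring)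

end Extensions

namespace ProductFormula

variable {K : Type*} [Field K] (M : ProductFormula K)

/-- The algebraic extension `E / K` is totally `v`-adic of type `(e, f)`: every `K`-embedding of
`E` into the algebraic closure of `K_v` has its image in a finite extension `F` of `K_v` whose
ramification index and residue degree, with respect to the (unique) extension `w` of the absolute
value of `K_v` to `F`, are at most `e` and `f`. -/
def IsTotallyAdic (v : M.Place) (e f : ℕ) (E : Type*) [Field E] [Algebra K E] : Prop :=
  ∀ σ : E →ₐ[K] M.ComplBar v,
    ∃ F : IntermediateField (M.Compl v) (M.ComplBar v),
      FiniteDimensional (M.Compl v) F ∧ (∀ x, σ x ∈ F) ∧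
      ∃ w : Valuation F ℝ≥0, (∀ x : M.Compl v, (w (algebraMap (M.Compl v) F x) : ℝ) = ‖x‖) ∧
        ramificationIndex (M.Compl v) w ≤ e ∧ residueDegree (M.Compl v) w ≤ f

/-- `α` is totally `v`-adic of type `(e, f)` if `K(α)` is. -/
def IsTotallyAdicElement (v : M.Place) (e f : ℕ) (α : AlgebraicClosure K) : Prop :=
  M.IsTotallyAdic v e f (IntermediateField.adjoin K {α})

end ProductFormula

end

/-! The proof plays an upper bound for a Vandermonde determinant against the product formula. Let α
have n conjugates z_i, and let V be their Vandermonde determinant. V² is Galois invariant and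
nonzero, so ∑_w n_w log|V|_w = 0. Replacing the monomials X^j by any polynomials of degree j
multiplies V only by the product of their leading coefficients, so each place may use its own
polynomials.

Away from v these are products of iterates of φ, chosen by the base-d digits of j, where d = deg φ
(`digitPoly`). Their leading coefficients lie in K and disappear globally by the product formula; at
v they are units by good reduction, so nothing is lost by changing polynomials there. Summed over
all places this costs at most about 2n²·ĥ(α) + O(n log n), since h(φ^k α) = d^k·ĥ(α) + O(1) and only
O(log n) iterates occur (`log_conjVandermonde_le`, `weight_mul_gain_le`).

At v, local compactness and the bounds e, f yield N and ρ < 1, independent of α, such that values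
below 1 on K(α) are at most ρ and there are at most N residue classes (`exists_hasValueGap`). With D
= N! + 1 the polynomial X^D − X is then at most ρ on integral conjugates, and its powers make |V|_v
smaller by a factor ρ^s with s about n²/(6D) (`log_conjVandermonde_add_gain_le`). Comparing the n²
terms, ĥ(α) < C = n_v(−log ρ)/(24D) forces n to be bounded (`exists_card_conjugates_le`). The
O-terms depend on φ, but C does not.

Northcott needs the degree, whereas n is only the separable degree. If some place is archimedean, K
has characteristic 0 and the two agree. If all places are ultrametric, a pigeonhole argument of
Siegel type produces a polynomial of degree less than deg α, with controlled coefficients and very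
small v-adically at every conjugate; the product formula then bounds deg α (`exists_natDegree_le`).
If v is trivial, the residue degree bounds deg α directly (`natDegree_le_of_not_isNontrivial`).
Preperiodic points have ĥ = 0 < C, which gives the second claim. -/

namespace ProductFormula

/-! ### Absolute values on completions and on the algebraic closure. -/

variable {K : Type*} [Field K] (M : ProductFormula K)

theorem norm_algebraMap_compl (w : M.Place) (x : K) :
    ‖algebraMap K (M.Compl w) x‖ = M.absVal w x :=
  UniformSpace.Completion.norm_coe (E := WithAbs (M.absVal w)) (WithAbs.toAbs _ x)

theorem denseRange_algebraMap_compl (w : M.Place) :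
    DenseRange (algebraMap K (M.Compl w)) := by
  have h := UniformSpace.Completion.denseRange_coe (α := WithAbs (M.absVal w))
  refine h.mono ?_
  rintro _ ⟨x, rfl⟩
  exact ⟨WithAbs.ofAbs x, rfl⟩

theorem isNonarchimedean_norm_compl {w : M.Place} (hw : IsNonarchimedean (M.absVal w)) :
    IsNonarchimedean (norm : M.Compl w → ℝ) := by
  intro x y
  have hcl : IsClosed {p : M.Compl w × M.Compl w | ‖p.1 + p.2‖ ≤ max ‖p.1‖ ‖p.2‖} :=
    isClosed_le (by fun_prop) (by fun_prop)
  have hd := (M.denseRange_algebraMap_compl w).prodMap (M.denseRange_algebraMap_compl w)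
  have : ∀ p : M.Compl w × M.Compl w, p ∈ {p : M.Compl w × M.Compl w |
      ‖p.1 + p.2‖ ≤ max ‖p.1‖ ‖p.2‖} := by
    intro p
    refine hd.induction_on p hcl ?_
    rintro ⟨a, b⟩
    simp only [Set.mem_ofPred_eq, Prod.map_apply, ← map_add, norm_algebraMap_compl]
    exact hw a b
  exact this (x, y)

theorem isUltrametricDist_compl {w : M.Place} (hw : IsNonarchimedean (M.absVal w)) :
    IsUltrametricDist (M.Compl w) :=
  IsUltrametricDist.isUltrametricDist_of_isNonarchimedean_norm
    (M.isNonarchimedean_norm_compl hw)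

theorem norm_compl_of_not_isNontrivial {w : M.Place} (hw : ¬ (M.absVal w).IsNontrivial)
    (x : M.Compl w) : (x = 0 ∧ ‖x‖ = 0) ∨ ‖x‖ = 1 := by
  have hcl : IsClosed {p : M.Compl w | ‖p‖ ∈ ({0, 1} : Set ℝ)} :=
    IsClosed.preimage continuous_norm (Set.toFinite _).isClosed
  have : ‖x‖ ∈ ({0, 1} : Set ℝ) := by
    refine (M.denseRange_algebraMap_compl w).induction_on x hcl fun a => ?_
    rw [norm_algebraMap_compl]
    by_cases ha : a = 0
    · simp [ha]
    · right
      by_contra h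
      exact hw ⟨a, ha, h⟩
  rcases this with h | h
  · exact Or.inl ⟨norm_eq_zero.mp h, h⟩
  · exact Or.inr h

/-- The completion at a nontrivial place as a nontrivially normed field. -/
noncomputable abbrev nontriviallyNormedFieldCompl {w : M.Place} (hw : (M.absVal w).IsNontrivial) :
    NontriviallyNormedField (M.Compl w) :=
  .ofNormNeOne <| by
    obtain ⟨x, hx, h⟩ := hw
    refine ⟨algebraMap K _ x, by simpa using hx, ?_⟩
    rwa [norm_algebraMap_compl]

theorem extAbs_eq_spectralNorm {w : M.Place} (hw : IsNonarchimedean (M.absVal w))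
    (hw' : (M.absVal w).IsNontrivial) (z : M.ComplBar w) :
    M.extAbs w z = spectralNorm (M.Compl w) (M.ComplBar w) z := by
  let := M.nontriviallyNormedFieldCompl hw'
  have := M.isUltrametricDist_compl hw
  exact (spectralNorm.spectralNorm_eq_norm_coeff_zero_rpow (M.Compl w) (M.ComplBar w) z).symm

theorem extAbs_zero (w : M.Place) : M.extAbs w 0 = 0 := by
  simp [extAbs, minpoly.zero]

theorem extAbs_of_not_isNontrivial {w : M.Place} (hw : ¬ (M.absVal w).IsNontrivial)
    {z : M.ComplBar w} (hz : z ≠ 0) : M.extAbs w z = 1 := by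
  have h0 : (minpoly (M.Compl w) z).coeff 0 ≠ 0 :=
    minpoly.coeff_zero_ne_zero (Algebra.IsIntegral.isIntegral z) hz
  rcases M.norm_compl_of_not_isNontrivial hw ((minpoly (M.Compl w) z).coeff 0) with h | h
  · exact absurd h.1 h0
  · simp [extAbs, h]

theorem norm_coeff_zero_rpow_of_norm_roots_eq {p : ℂ[X]} (hp : p.Monic) (hd : 0 < p.natDegree)
    {r : ℝ} (hr : 0 ≤ r) (h : ∀ x ∈ p.roots, ‖x‖ = r) :
    ‖p.coeff 0‖ ^ (1 / (p.natDegree : ℝ)) = r := by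
  have hs := IsAlgClosed.splits p
  have h2 : p.roots.map (normHom : ℂ →*₀ ℝ) = Multiset.replicate (Multiset.card p.roots) r := by
    rw [Multiset.eq_replicate]
    refine ⟨by simp, fun b hb => ?_⟩
    obtain ⟨x, hx, rfl⟩ := Multiset.mem_map.mp hb
    exact h x hx
  have h3 : ‖p.roots.prod‖ = r ^ p.natDegree := by
    have := map_multiset_prod (normHom : ℂ →*₀ ℝ) p.roots
    rw [h2, Multiset.prod_replicate, splits_iff_card_roots.mp hs] at this
    exact this
  rw [hs.coeff_zero_eq_prod_roots_of_monic hp, norm_mul, norm_pow, norm_neg, norm_one, one_pow,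
    one_mul, h3, one_div]
  exact Real.pow_rpow_inv_natCast hr hd.ne'

/-- The image of K_w in ℂ is closed and contains ℚ, hence ℝ. So every z is a root of a real
quadratic whose roots are τ z and its complex conjugate, and all roots of the minimal polynomial
have the same absolute value. -/
theorem exists_extAbs_eq_norm {w : M.Place} (hw : ¬ IsNonarchimedean (M.absVal w)) :
    ∃ τ : M.ComplBar w →+* ℂ, ∀ z, M.extAbs w z = ‖τ z‖ := by
  obtain ⟨σ, hσ⟩ := M.exists_embedding w hw
  let g : WithAbs (M.absVal w) →+* ℂ := σ.comp (WithAbs.equiv (M.absVal w)).toRingHom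
  have hg : Isometry g := AddMonoidHomClass.isometry_of_norm g fun x => (hσ _).symm
  let θ : M.Compl w →+* ℂ := UniformSpace.Completion.extensionHom g hg.continuous
  have hθ : Isometry θ := hg.completion_extension
  have hnorm : ∀ x, ‖θ x‖ = ‖x‖ := fun x => (AddMonoidHomClass.isometry_iff_norm θ).mp hθ x
  have hreal : ∀ r : ℝ, ∃ a, θ a = (r : ℂ) := by
    intro r
    have hcl : IsClosed (Set.range θ) := hθ.isClosedEmbedding.isClosed_range
    have : ∀ s : ℝ, (s : ℂ) ∈ Set.range θ := by
      intro s
      refine Rat.denseRange_cast.induction_on s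
        (p := fun s : ℝ => (s : ℂ) ∈ Set.range θ) (hcl.preimage Complex.continuous_ofReal) ?_
      intro q
      obtain ⟨n, m, hm, rfl⟩ : ∃ n m : ℤ, m ≠ 0 ∧ q = n / m :=
        ⟨q.num, q.den, by simp, (Rat.num_div_den q).symm⟩
      exact ⟨n / m, by simp⟩
    exact this r
  let : Algebra (M.Compl w) ℂ := θ.toAlgebra
  let τ : M.ComplBar w →ₐ[M.Compl w] ℂ := IsAlgClosed.lift
  refine ⟨τ, fun z => ?_⟩
  have hint : IsIntegral (M.Compl w) z := Algebra.IsIntegral.isIntegral z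
  have hmon := minpoly.monic hint
  set p := minpoly (M.Compl w) z with hp
  obtain ⟨a, ha⟩ := hreal (2 * (τ z).re)
  obtain ⟨b, hb⟩ := hreal (‖τ z‖ ^ 2)
  have key : ∀ x : ℂ, x ^ 2 - θ a * x + θ b = (x - τ z) * (x - (starRingEnd ℂ) (τ z)) := by
    intro x
    have h1 : θ a = τ z + (starRingEnd ℂ) (τ z) := by rw [ha, Complex.add_conj]
    have h2 : θ b = τ z * (starRingEnd ℂ) (τ z) := by rw [hb, Complex.mul_conj']; push_cast; rfl
    rw [h1, h2]; ring
  have hdvd : p ∣ X ^ 2 - C a * X + C b := by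
    apply minpoly.dvd
    refine τ.injective ?_
    rw [map_zero]
    refine (aeval_algHom_apply τ z _).symm.trans ?_
    have : aeval (τ z) (X ^ 2 - C a * X + C b) = (τ z) ^ 2 - θ a * τ z + θ b := by
      simp; rfl
    rw [this, key]
    simp
  have hroots : ∀ x ∈ (p.map θ).roots, ‖x‖ = ‖τ z‖ := by
    intro x hx
    rw [mem_roots (hmon.map θ).ne_zero, IsRoot.def] at hx
    have h0 : eval x ((X ^ 2 - C a * X + C b).map θ) = 0 :=
      eval_eq_zero_of_dvd_of_eval_eq_zero (Polynomial.map_dvd θ hdvd) hx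
    have h1 : eval x ((X ^ 2 - C a * X + C b).map θ) = x ^ 2 - θ a * x + θ b := by simp
    rw [h1, key, mul_eq_zero, sub_eq_zero, sub_eq_zero] at h0
    rcases h0 with h | h
    · rw [h]
    · rw [h, RCLike.norm_conj]
  have := norm_coeff_zero_rpow_of_norm_roots_eq (hmon.map θ)
    (by rw [natDegree_map]; exact minpoly.natDegree_pos hint) (norm_nonneg (τ z)) hroots
  rw [natDegree_map, coeff_map, hnorm] at this
  exact this

/-- The formula defining `extAbs` is not visibly additive or multiplicative. Three sources supply
this: the spectral norm (which needs a nontrivial ultrametric base), the trivial absolute value, and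
the norm pulled back from ℂ. -/
theorem exists_absoluteValue_extAbs (w : M.Place) :
    ∃ f : AbsoluteValue (M.ComplBar w) ℝ, (∀ z, f z = M.extAbs w z) ∧
      (IsNonarchimedean (M.absVal w) → IsNonarchimedean f) := by
  classical
  by_cases hw : IsNonarchimedean (M.absVal w)
  · by_cases hw' : (M.absVal w).IsNontrivial
    · let := M.nontriviallyNormedFieldCompl hw'
      have := M.isUltrametricDist_compl hw
      have hf := M.extAbs_eq_spectralNorm hw hw'
      let g := spectralMulAlgNorm (M.Compl w) (M.ComplBar w)
      have hg : ∀ z, g z = M.extAbs w z := fun z => (hf z).symm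
      have hna : IsNonarchimedean g := isNonarchimedean_spectralNorm
      refine ⟨⟨⟨fun z => g z, fun x y => map_mul g x y⟩, fun z => apply_nonneg g z, fun z =>
        ⟨fun h => ?_, fun h => by simp [h]⟩, fun x y => map_add_le_add g x y⟩, hg, fun _ => hna⟩
      by_contra hz
      have h1 : g (z * z⁻¹) = 1 := by rw [mul_inv_cancel₀ hz]; exact map_one g
      rw [map_mul] at h1
      have h2 : g z = 0 := h
      rw [h2, zero_mul] at h1
      exact zero_ne_one h1
    · have h1 := fun z (hz : z ≠ 0) => M.extAbs_of_not_isNontrivial hw' hz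
      refine ⟨AbsoluteValue.trivial, fun z => ?_, fun _ x y => ?_⟩
      · by_cases hz : z = 0
        · simp [hz, extAbs_zero]
        · rw [h1 z hz, AbsoluteValue.trivial_apply hz]
      · by_cases hx : x = 0
        · simp [hx]
        by_cases hxy : x + y = 0
        · simp [hxy]
        · rw [AbsoluteValue.trivial_apply hx, AbsoluteValue.trivial_apply hxy]
          exact le_max_left _ _
  · obtain ⟨τ, hτ⟩ := M.exists_extAbs_eq_norm hw
    refine ⟨(NormedField.toAbsoluteValue ℂ).comp τ.injective, fun z => (hτ z).symm,
      fun h => absurd h hw⟩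

/-- The absolute value on `K̄` induced by the embedding at `w`. -/
noncomputable def placeAbs (w : M.Place) : AbsoluteValue (AlgebraicClosure K) ℝ :=
  (M.exists_absoluteValue_extAbs w).choose.comp (M.embed w).toRingHom.injective

theorem placeAbs_apply (w : M.Place) (z : AlgebraicClosure K) :
    M.placeAbs w z = M.extAbs w (M.embed w z) :=
  (M.exists_absoluteValue_extAbs w).choose_spec.1 _

theorem placeAbs_isNonarchimedean {w : M.Place} (hw : IsNonarchimedean (M.absVal w)) :
    IsNonarchimedean (M.placeAbs w) := by
  intro x y
  have := (M.exists_absoluteValue_extAbs w).choose_spec.2 hw (M.embed w x) (M.embed w y)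
  rw [← map_add] at this
  exact this

theorem extAbs_algebraMap (w : M.Place) (x : M.Compl w) :
    M.extAbs w (algebraMap _ _ x) = ‖x‖ := by
  simp [extAbs, minpoly.eq_X_sub_C]

theorem placeAbs_algebraMap (w : M.Place) (x : K) :
    M.placeAbs w (algebraMap K _ x) = M.absVal w x := by
  rw [placeAbs_apply, AlgHom.commutes,
    IsScalarTower.algebraMap_apply K (M.Compl w) (M.ComplBar w), extAbs_algebraMap,
    norm_algebraMap_compl]

end ProductFormula

/-! ### Weighted sums over places and the product formula on `AlgebraicClosure K`. -/

namespace ProductFormula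

variable {K : Type*} [Field K] (M : ProductFormula K)

/-- Weighted sum of a real function over the places. -/
noncomputable def wsum (f : M.Place → ℝ) : ℝ := ∑ᶠ w, M.weight w * f w

variable {M} in
theorem wsum_eq_sum {f : M.Place → ℝ} {T : Finset M.Place} (h : f.support ⊆ T) :
    M.wsum f = ∑ w ∈ T, M.weight w * f w :=
  finsum_eq_sum_of_support_subset _ fun _ hw => h (right_ne_zero_of_mul hw)

theorem wsum_zero : M.wsum (fun _ => 0) = 0 := by simp [wsum]

theorem wsum_add {f g : M.Place → ℝ} (hf : f.support.Finite) (hg : g.support.Finite) :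
    M.wsum (fun w => f w + g w) = M.wsum f + M.wsum g := by
  classical
  have h1 : f.support ⊆ (hf.toFinset ∪ hg.toFinset : Finset _) := by simp
  have h2 : g.support ⊆ (hf.toFinset ∪ hg.toFinset : Finset _) := by simp
  have h3 : (fun w => f w + g w).support ⊆ (hf.toFinset ∪ hg.toFinset : Finset _) := by
    simpa using Function.support_add f g
  rw [wsum_eq_sum h1, wsum_eq_sum h2, wsum_eq_sum h3, ← Finset.sum_add_distrib]
  simp only [mul_add]

theorem wsum_const_mul (c : ℝ) (f : M.Place → ℝ) :
    M.wsum (fun w => c * f w) = c * M.wsum f := by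
  simp only [wsum, mul_left_comm _ c]
  by_cases hc : c = 0
  · simp [hc]
  · by_cases hf : (fun w => M.weight w * f w).support.Finite
    · exact (mul_finsum _ _).symm
    · have h2 : ¬ (fun w => c * (M.weight w * f w)).support.Finite := by
        convert hf using 2
        ext w; simp [hc]
      rw [finsum_of_infinite_support hf, finsum_of_infinite_support h2, mul_zero]

theorem support_sum_finite {ι : Type*} {s : Finset ι} {f : ι → M.Place → ℝ}
    (hf : ∀ i ∈ s, (f i).support.Finite) : (fun w => ∑ i ∈ s, f i w).support.Finite := by
  refine Set.Finite.subset (s.finite_toSet.biUnion hf) fun w hw => ?_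
  obtain ⟨i, hi, h⟩ := Finset.exists_ne_zero_of_sum_ne_zero hw
  exact Set.mem_biUnion hi h

theorem wsum_sum {ι : Type*} (s : Finset ι) {f : ι → M.Place → ℝ}
    (hf : ∀ i ∈ s, (f i).support.Finite) :
    M.wsum (fun w => ∑ i ∈ s, f i w) = ∑ i ∈ s, M.wsum (f i) := by
  classical
  induction s using Finset.induction_on with
  | empty => simp [wsum_zero]
  | insert a s ha ih =>
    simp only [Finset.sum_insert ha]
    rw [M.wsum_add (hf a (Finset.mem_insert_self a s))
      (M.support_sum_finite fun i hi => hf i (Finset.mem_insert_of_mem hi)),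
      ih fun i hi => hf i (Finset.mem_insert_of_mem hi)]

theorem wsum_mono {f g : M.Place → ℝ} (hf : f.support.Finite) (hg : g.support.Finite)
    (h : ∀ w, f w ≤ g w) : M.wsum f ≤ M.wsum g := by
  classical
  have h1 : f.support ⊆ (hf.toFinset ∪ hg.toFinset : Finset _) := by simp
  have h2 : g.support ⊆ (hf.toFinset ∪ hg.toFinset : Finset _) := by simp
  rw [wsum_eq_sum h1, wsum_eq_sum h2]
  exact Finset.sum_le_sum fun w _ => mul_le_mul_of_nonneg_left (h w) (M.weight_pos w).le

theorem wsum_nonneg {f : M.Place → ℝ} (h : ∀ w, 0 ≤ f w) : 0 ≤ M.wsum f :=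
  finsum_nonneg fun w => mul_nonneg (M.weight_pos w).le (h w)

open Classical in
theorem wsum_single (v : M.Place) (c : ℝ) :
    M.wsum (fun w => if w = v then c else 0) = M.weight v * c := by
  rw [wsum_eq_sum (T := {v}) (fun w hw => by
    by_contra h
    exact hw (if_neg (by simpa using h)))]
  simp

theorem wsum_log_absVal {x : K} (hx : x ≠ 0) :
    M.wsum (fun w => Real.log (M.absVal w x)) = 0 := by
  have hf := M.finite_ne_one x hx
  have h1 : (fun w => Real.log (M.absVal w x)).support ⊆ hf.toFinset := by
    intro w hw
    simp only [Set.Finite.coe_toFinset, Set.mem_ofPred_eq]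
    intro h
    exact hw (by simp [h])
  have h2 : Function.mulSupport (fun w => M.absVal w x ^ M.weight w) ⊆ hf.toFinset := by
    intro w hw
    simp only [Set.Finite.coe_toFinset, Set.mem_ofPred_eq]
    intro h
    exact hw (by simp [h])
  have h3 := M.prod_eq_one x hx
  rw [finprod_eq_prod_of_mulSupport_subset _ h2] at h3
  have h4 := congrArg Real.log h3
  rw [Real.log_one, Real.log_prod fun w _ =>
    (Real.rpow_pos_of_pos ((M.absVal w).pos hx) _).ne'] at h4
  rw [wsum_eq_sum h1, ← h4]
  exact Finset.sum_congr rfl fun w _ => (Real.log_rpow ((M.absVal w).pos hx) _).symm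

theorem placeAbs_le_one_of_coeff_le_one {w : M.Place} (hw : IsNonarchimedean (M.absVal w))
    {p : K[X]} (hp : p.Monic) (h : ∀ i, M.absVal w (p.coeff i) ≤ 1) {z : AlgebraicClosure K}
    (hz : aeval z p = 0) : M.placeAbs w z ≤ 1 := by
  by_contra! hlt
  have hna := M.placeAbs_isNonarchimedean hw
  have hd : p.natDegree ≠ 0 := by
    intro h0
    rw [hp.natDegree_eq_zero.mp h0] at hz
    simp at hz
  rw [aeval_eq_sum_range, Finset.sum_range_succ, hp.coeff_natDegree, one_smul] at hz
  have h1 : z ^ p.natDegree = -∑ i ∈ Finset.range p.natDegree, p.coeff i • z ^ i := by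
    rw [eq_neg_iff_add_eq_zero, add_comm]; exact hz
  have h2 : M.placeAbs w z ^ p.natDegree ≤ M.placeAbs w z ^ (p.natDegree - 1) := by
    rw [← map_pow, h1, AbsoluteValue.map_neg]
    obtain ⟨i, hi, hle⟩ := hna.finset_image_add_of_nonempty
      (fun i => p.coeff i • z ^ i) (t := Finset.range p.natDegree) (by simpa using hd)
    refine hle.trans ?_
    rw [Algebra.smul_def, map_mul, placeAbs_algebraMap, map_pow]
    rw [Finset.mem_range] at hi
    calc _ ≤ 1 * M.placeAbs w z ^ i := by
          gcongr; exact h i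
      _ ≤ _ := by
          rw [one_mul]; exact pow_le_pow_right₀ hlt.le (by omega)
  exact absurd h2 (not_le.mpr (pow_lt_pow_right₀ hlt (by omega)))

theorem finite_coeff_gt_one (p : K[X]) : {w | ∃ i, 1 < M.absVal w (p.coeff i)}.Finite := by
  refine Set.Finite.subset (p.support.finite_toSet.biUnion
    (t := fun i => {w | M.absVal w (p.coeff i) ≠ 1 ∧ p.coeff i ≠ 0}) fun i hi =>
      (M.finite_ne_one _ (mem_support_iff.mp hi)).subset fun w hw => hw.1) ?_
  rintro w ⟨i, hi⟩
  have h0 : p.coeff i ≠ 0 := by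
    intro h
    rw [h, map_zero] at hi
    linarith
  exact Set.mem_biUnion (mem_support_iff.mpr h0) ⟨hi.ne', h0⟩

theorem finite_one_lt_placeAbs (z : AlgebraicClosure K) : {w | 1 < M.placeAbs w z}.Finite := by
  have hint : IsIntegral K z := Algebra.IsIntegral.isIntegral z
  refine ((M.finite_not_isNonarchimedean).union (M.finite_coeff_gt_one (minpoly K z))).subset ?_
  intro w hw
  by_contra h
  simp only [Set.mem_union, Set.mem_ofPred_eq, not_or, not_not, not_exists, not_lt] at h
  exact absurd (M.placeAbs_le_one_of_coeff_le_one h.1 (minpoly.monic hint) h.2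
    (minpoly.aeval K z)) (not_le.mpr hw)

theorem finite_placeAbs_ne_one {z : AlgebraicClosure K} (hz : z ≠ 0) :
    {w | M.placeAbs w z ≠ 1}.Finite := by
  refine ((M.finite_one_lt_placeAbs z).union (M.finite_one_lt_placeAbs z⁻¹)).subset ?_
  intro w hw
  rcases lt_or_gt_of_ne hw with h | h
  · right
    simp only [Set.mem_ofPred_eq, map_inv₀]
    exact (one_lt_inv₀ ((M.placeAbs w).pos hz)).mpr h
  · exact Or.inl h

theorem support_log_placeAbs (z : AlgebraicClosure K) :
    (fun w => Real.log (M.placeAbs w z)).support.Finite := by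
  by_cases hz : z = 0
  · simp [hz]
  · refine (M.finite_placeAbs_ne_one hz).subset fun w hw h => hw (by simp [h])

theorem support_posLog_placeAbs (z : AlgebraicClosure K) :
    (fun w => Real.posLog (M.placeAbs w z)).support.Finite := by
  by_cases hz : z = 0
  · simp [hz]
  · refine (M.finite_placeAbs_ne_one hz).subset fun w hw h => hw (by simp [h])

theorem mem_conjugates_iff {α z : AlgebraicClosure K} :
    z ∈ conjugates α ↔ ∃ σ : AlgebraicClosure K ≃ₐ[K] AlgebraicClosure K, σ α = z := by
  have hint : IsIntegral K α := Algebra.IsIntegral.isIntegral α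
  rw [conjugates, Set.Finite.mem_toFinset, mem_rootSet]
  constructor
  · rintro ⟨-, h⟩
    exact minpoly.exists_algEquiv_of_root' (Algebra.IsAlgebraic.isAlgebraic α) h
  · rintro ⟨σ, rfl⟩
    refine ⟨minpoly.ne_zero hint, ?_⟩
    rw [aeval_algEquiv]
    simp

theorem conjugates_nonempty (α : AlgebraicClosure K) : (conjugates α).Nonempty :=
  ⟨α, mem_conjugates_iff.mpr ⟨AlgEquiv.refl, rfl⟩⟩

/-- A Galois-fixed β need not lie in K, since K may be imperfect. But β is the only root of its
minimal polynomial, whose constant coefficient is therefore a power of β up to sign, and the product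
formula applies to that coefficient. -/
theorem wsum_log_placeAbs_of_fixed {β : AlgebraicClosure K} (h0 : β ≠ 0)
    (hβ : ∀ σ : AlgebraicClosure K ≃ₐ[K] AlgebraicClosure K, σ β = β) :
    M.wsum (fun w => Real.log (M.placeAbs w β)) = 0 := by
  have hint : IsIntegral K β := Algebra.IsIntegral.isIntegral β
  set p := minpoly K β
  have hd : p.natDegree ≠ 0 := (minpoly.natDegree_pos hint).ne'
  have hmon : p.Monic := minpoly.monic hint
  have hs := IsAlgClosed.splits (p.map (algebraMap K (AlgebraicClosure K)))
  have hc := hs.coeff_zero_eq_prod_roots_of_monic (hmon.map _)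
  have hr : (p.map (algebraMap K (AlgebraicClosure K))).roots =
      Multiset.replicate p.natDegree β := by
    rw [Multiset.eq_replicate]
    refine ⟨?_, fun b hb => ?_⟩
    · rw [← hs.natDegree_eq_card_roots, natDegree_map]
    · have : b ∈ conjugates β := by
        rw [conjugates, Set.Finite.mem_toFinset, mem_rootSet]
        rw [mem_roots', IsRoot.def, eval_map_algebraMap] at hb
        exact ⟨minpoly.ne_zero hint, hb.2⟩
      obtain ⟨σ, rfl⟩ := mem_conjugates_iff.mp this
      exact hβ σ
  rw [hr, Multiset.prod_replicate, coeff_map, natDegree_map] at hc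
  have hne : p.coeff 0 ≠ 0 := minpoly.coeff_zero_ne_zero hint h0
  have key : ∀ w, Real.log (M.absVal w (p.coeff 0)) =
      p.natDegree * Real.log (M.placeAbs w β) := by
    intro w
    rw [← placeAbs_algebraMap, hc, map_mul, map_pow, map_pow, AbsoluteValue.map_neg, map_one, one_pow, one_mul,
      Real.log_pow]
  have := M.wsum_log_absVal hne
  simp only [key] at this
  rw [wsum_const_mul] at this
  exact (mul_eq_zero.mp this).resolve_left (by exact_mod_cast hd)

end ProductFormula

/-! ### Heights as averages over conjugates, and canonical heights. -/

namespace ProductFormula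

variable {K : Type*} [Field K] (M : ProductFormula K)

/-- Average of a real function over the conjugates of `α`. -/
noncomputable def conjAvg (α : AlgebraicClosure K) (G : AlgebraicClosure K → ℝ) : ℝ :=
  (1 / ((conjugates α).card : ℝ)) * ∑ z ∈ conjugates α, G z

theorem card_conjugates_pos (α : AlgebraicClosure K) : 0 < (conjugates α).card :=
  Finset.card_pos.mpr (conjugates_nonempty α)

/-- By equivariance the Galois group permutes the fibres of f on the conjugates of α transitively,
so all fibres have the same size. This expresses the height of every iterate over the conjugates of
α itself. -/
theorem conjAvg_comp {f : AlgebraicClosure K → AlgebraicClosure K}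
    (hf : ∀ (σ : AlgebraicClosure K ≃ₐ[K] AlgebraicClosure K) z, σ (f z) = f (σ z))
    (α : AlgebraicClosure K) (G : AlgebraicClosure K → ℝ) :
    conjAvg (f α) G = conjAvg α (fun z => G (f z)) := by
  classical
  have hmaps : ∀ z ∈ conjugates α, f z ∈ conjugates (f α) := by
    intro z hz
    obtain ⟨σ, rfl⟩ := mem_conjugates_iff.mp hz
    exact mem_conjugates_iff.mpr ⟨σ, hf σ α⟩
  have hcard : ∀ y ∈ conjugates (f α), ((conjugates α).filter (fun z => f z = y)).card =
      ((conjugates α).filter (fun z => f z = f α)).card := by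
    intro y hy
    obtain ⟨σ, rfl⟩ := mem_conjugates_iff.mp hy
    symm
    refine Finset.card_bij (fun z _ => σ z) ?_ (fun _ _ _ _ h => σ.injective h) ?_
    · intro z hz
      rw [Finset.mem_filter] at hz ⊢
      obtain ⟨τ, rfl⟩ := mem_conjugates_iff.mp hz.1
      exact ⟨mem_conjugates_iff.mpr ⟨τ.trans σ, rfl⟩, by rw [← hf, hz.2]⟩
    · intro z hz
      rw [Finset.mem_filter] at hz
      obtain ⟨τ, rfl⟩ := mem_conjugates_iff.mp hz.1
      refine ⟨σ.symm (τ α), ?_, σ.apply_symm_apply _⟩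
      rw [Finset.mem_filter]
      exact ⟨mem_conjugates_iff.mpr ⟨τ.trans σ.symm, rfl⟩, by rw [← hf, hz.2, σ.symm_apply_apply]⟩
  set c := ((conjugates α).filter (fun z => f z = f α)).card with hc
  have h1 : ∑ z ∈ conjugates α, G (f z) = c * ∑ y ∈ conjugates (f α), G y := by
    rw [← Finset.sum_fiberwise_of_maps_to hmaps, Finset.mul_sum]
    refine Finset.sum_congr rfl fun y hy => ?_
    rw [Finset.sum_congr rfl (g := fun _ => G y) (fun z hz => by
      rw [(Finset.mem_filter.mp hz).2]), Finset.sum_const, hcard y hy, nsmul_eq_mul]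
  have h2 : (conjugates α).card = c * (conjugates (f α)).card := by
    rw [Finset.card_eq_sum_card_fiberwise hmaps, Finset.sum_congr rfl hcard, Finset.sum_const,
      smul_eq_mul, mul_comm]
  have h3 := card_conjugates_pos α
  have hc0 : (c : ℝ) ≠ 0 := by
    intro h
    rw [Nat.cast_eq_zero.mp h, zero_mul] at h2
    omega
  have h4 : ((conjugates (f α)).card : ℝ) ≠ 0 := by
    exact_mod_cast (card_conjugates_pos (f α)).ne'
  rw [conjAvg, conjAvg, h1, h2]
  push_cast
  field_simp

theorem conjAvg_mono {α : AlgebraicClosure K} {F G : AlgebraicClosure K → ℝ}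
    (h : ∀ z ∈ conjugates α, F z ≤ G z) : conjAvg α F ≤ conjAvg α G :=
  mul_le_mul_of_nonneg_left (Finset.sum_le_sum h) (by positivity)

theorem conjAvg_add (α : AlgebraicClosure K) (F G : AlgebraicClosure K → ℝ) :
    conjAvg α (fun z => F z + G z) = conjAvg α F + conjAvg α G := by
  rw [conjAvg, Finset.sum_add_distrib, mul_add]; rfl

theorem conjAvg_const_mul (α : AlgebraicClosure K) (c : ℝ) (G : AlgebraicClosure K → ℝ) :
    conjAvg α (fun z => c * G z) = c * conjAvg α G := by
  rw [conjAvg, ← Finset.mul_sum, conjAvg]; ring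

theorem conjAvg_const (α : AlgebraicClosure K) (c : ℝ) : conjAvg α (fun _ => c) = c := by
  have h4 : ((conjugates α).card : ℝ) ≠ 0 := by
    exact_mod_cast (card_conjugates_pos α).ne'
  rw [conjAvg, Finset.sum_const, nsmul_eq_mul]
  field_simp

theorem sum_conjugates_eq (α : AlgebraicClosure K) (G : AlgebraicClosure K → ℝ) :
    ∑ z ∈ conjugates α, G z = (conjugates α).card * conjAvg α G := by
  have h4 : ((conjugates α).card : ℝ) ≠ 0 := by
    exact_mod_cast (card_conjugates_pos α).ne'
  rw [conjAvg]
  field_simp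

/-- The contribution `∑_w n_w log⁺ |z|_w` of one conjugate to the height. -/
noncomputable def localHeightSum (z : AlgebraicClosure K) : ℝ :=
  M.wsum (fun w => Real.posLog (M.placeAbs w z))

theorem height_eq_conjAvg (α : AlgebraicClosure K) :
    M.height α = conjAvg α M.localHeightSum := by
  simp only [height, conjAvg, localHeightSum, wsum, placeAbs_apply]

theorem height_nonneg (α : AlgebraicClosure K) : 0 ≤ M.height α := by
  rw [height_eq_conjAvg, conjAvg]
  exact mul_nonneg (by positivity)
    (Finset.sum_nonneg fun z _ => M.wsum_nonneg fun w => Real.posLog_nonneg)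

theorem map_polyMap (φ : K[X]) (σ : AlgebraicClosure K ≃ₐ[K] AlgebraicClosure K)
    (z : AlgebraicClosure K) : σ (polyMap φ z) = polyMap φ (σ z) :=
  (aeval_algHom_apply (σ : AlgebraicClosure K →ₐ[K] AlgebraicClosure K) z φ).symm

theorem map_polyMap_iterate (φ : K[X]) (k : ℕ) (σ : AlgebraicClosure K ≃ₐ[K] AlgebraicClosure K)
    (z : AlgebraicClosure K) : σ ((polyMap φ)^[k] z) = (polyMap φ)^[k] (σ z) :=
  (Function.Semiconj.iterate_right (f := σ) (fun z => map_polyMap φ σ z) k) z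

theorem height_iterate (φ : K[X]) (k : ℕ) (α : AlgebraicClosure K) :
    M.height ((polyMap φ)^[k] α) =
      conjAvg α (fun z => M.localHeightSum ((polyMap φ)^[k] z)) := by
  rw [height_eq_conjAvg, conjAvg_comp (map_polyMap_iterate φ k)]

theorem placeAbs_polyMap_le_one {w : M.Place} (hw : IsNonarchimedean (M.absVal w)) {φ : K[X]}
    (h : M.GoodReduction w φ) {z : AlgebraicClosure K} (hz : M.placeAbs w z ≤ 1) :
    M.placeAbs w (polyMap φ z) ≤ 1 := by
  rw [polyMap, aeval_eq_sum_range]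
  obtain ⟨i, -, hle⟩ := (M.placeAbs_isNonarchimedean hw).finset_image_add_of_nonempty
    (fun i => φ.coeff i • z ^ i) (t := Finset.range (φ.natDegree + 1)) (by simp)
  refine hle.trans ?_
  rw [Algebra.smul_def, map_mul, placeAbs_algebraMap, map_pow]
  exact mul_le_one₀ (h.1 i) (by positivity) (pow_le_one₀ (by positivity) hz)

theorem placeAbs_polyMap_of_one_lt {w : M.Place} (hw : IsNonarchimedean (M.absVal w)) {φ : K[X]}
    (h : M.GoodReduction w φ) {z : AlgebraicClosure K} (hz : 1 < M.placeAbs w z) :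
    M.placeAbs w (polyMap φ z) = M.placeAbs w z ^ φ.natDegree := by
  have hna := M.placeAbs_isNonarchimedean hw
  rw [polyMap, aeval_eq_sum_range, Finset.sum_range_succ]
  have htop : M.placeAbs w (φ.coeff φ.natDegree • z ^ φ.natDegree) =
      M.placeAbs w z ^ φ.natDegree := by
    rw [Algebra.smul_def, map_mul, placeAbs_algebraMap, map_pow, coeff_natDegree, h.2, one_mul]
  by_cases hd : φ.natDegree = 0
  · rw [← htop, hd]; simp
  have hlt : M.placeAbs w (∑ i ∈ Finset.range φ.natDegree, φ.coeff i • z ^ i) <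
      M.placeAbs w (φ.coeff φ.natDegree • z ^ φ.natDegree) := by
    obtain ⟨i, hi, hle⟩ := hna.finset_image_add_of_nonempty
      (fun i => φ.coeff i • z ^ i) (t := Finset.range φ.natDegree) (by simpa using hd)
    refine hle.trans_lt ?_
    rw [htop, Algebra.smul_def, map_mul, placeAbs_algebraMap, map_pow]
    rw [Finset.mem_range] at hi
    calc _ ≤ 1 * M.placeAbs w z ^ i := by
          gcongr; exact h.1 i
      _ < _ := by
          rw [one_mul]; exact pow_lt_pow_right₀ hz hi
  rw [hna.add_eq_max_of_ne hlt.ne, max_eq_right hlt.le, htop]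

theorem max_one_placeAbs_polyMap {w : M.Place} (hw : IsNonarchimedean (M.absVal w)) {φ : K[X]}
    (h : M.GoodReduction w φ) (z : AlgebraicClosure K) :
    max 1 (M.placeAbs w (polyMap φ z)) = max 1 (M.placeAbs w z) ^ φ.natDegree := by
  rcases le_or_gt (M.placeAbs w z) 1 with hz | hz
  · rw [max_eq_left hz, max_eq_left (M.placeAbs_polyMap_le_one hw h hz), one_pow]
  · rw [max_eq_right hz.le, M.placeAbs_polyMap_of_one_lt hw h hz,
      max_eq_right (one_le_pow₀ hz.le)]

theorem exists_bound_max_polyMap (w : M.Place) {φ : K[X]} (hd : 1 ≤ φ.natDegree) :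
    ∃ C : ℝ, 1 ≤ C ∧ ∀ z,
      max 1 (M.placeAbs w (polyMap φ z)) ≤ C * max 1 (M.placeAbs w z) ^ φ.natDegree ∧
      max 1 (M.placeAbs w z) ^ φ.natDegree ≤ C * max 1 (M.placeAbs w (polyMap φ z)) := by
  set d := φ.natDegree
  set A : ℝ := ∑ i ∈ Finset.range d, M.absVal w (φ.coeff i) with hA
  have hA0 : 0 ≤ A := Finset.sum_nonneg fun i _ => by positivity
  set L : ℝ := M.absVal w (φ.coeff d) with hL
  have hL0 : 0 < L := (M.absVal w).pos (by
    rw [coeff_natDegree, leadingCoeff_ne_zero]; rintro rfl; simp [d] at hd)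
  have hlow : ∀ z, M.placeAbs w (∑ i ∈ Finset.range d, φ.coeff i • z ^ i) ≤
      A * max 1 (M.placeAbs w z) ^ (d - 1) := by
    intro z
    refine ((M.placeAbs w).sum_le _ _).trans ?_
    rw [hA, Finset.sum_mul]
    refine Finset.sum_le_sum fun i hi => ?_
    rw [Algebra.smul_def, map_mul, placeAbs_algebraMap, map_pow]
    rw [Finset.mem_range] at hi
    gcongr
    calc M.placeAbs w z ^ i ≤ max 1 (M.placeAbs w z) ^ i := by gcongr; exact le_max_right _ _
      _ ≤ _ := pow_le_pow_right₀ (le_max_left _ _) (by omega)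
  have hsplit : ∀ z, polyMap φ z = ∑ i ∈ Finset.range d, φ.coeff i • z ^ i +
      φ.coeff d • z ^ d := by
    intro z
    rw [polyMap, aeval_eq_sum_range, Finset.sum_range_succ]
  have htop : ∀ z, M.placeAbs w (φ.coeff d • z ^ d) = L * M.placeAbs w z ^ d := by
    intro z
    rw [Algebra.smul_def, map_mul, placeAbs_algebraMap, map_pow]
  have hup : ∀ z, max 1 (M.placeAbs w (polyMap φ z)) ≤
      (1 + A + L) * max 1 (M.placeAbs w z) ^ d := by
    intro z
    set y := max 1 (M.placeAbs w z) with hy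
    have hy1 : 1 ≤ y := le_max_left _ _
    have hyd : 1 ≤ y ^ d := one_le_pow₀ hy1
    refine max_le (by nlinarith) ?_
    rw [hsplit]
    refine ((M.placeAbs w).add_le _ _).trans ?_
    rw [htop]
    have h1 := hlow z
    have h2 : y ^ (d - 1) ≤ y ^ d := pow_le_pow_right₀ hy1 (by omega)
    have h3 : M.placeAbs w z ^ d ≤ y ^ d := by gcongr; exact le_max_right _ _
    nlinarith
  -- Beyond this radius the lower-order terms are at most half of the leading term.
  set B : ℝ := max 1 (2 * A / L) with hB
  have hB1 : 1 ≤ B := le_max_left _ _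
  have hdown : ∀ z, max 1 (M.placeAbs w z) ^ d ≤
      (B ^ d + 2 / L) * max 1 (M.placeAbs w (polyMap φ z)) := by
    intro z
    set y := max 1 (M.placeAbs w z) with hy
    set u := max 1 (M.placeAbs w (polyMap φ z)) with hu
    have hu1 : 1 ≤ u := le_max_left _ _
    have hy1 : 1 ≤ y := le_max_left _ _
    have hL2 : 0 < 2 / L := by positivity
    rcases le_or_gt y B with h | h
    · have : y ^ d ≤ B ^ d := by gcongr
      have hBd : 0 ≤ B ^ d := by positivity
      nlinarith [mul_nonneg hL2.le (zero_le_one.trans hu1), mul_le_mul_of_nonneg_left hu1 hBd]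
    · have hyz : y = M.placeAbs w z := by
        rcases le_or_gt (M.placeAbs w z) 1 with h' | h'
        · rw [hy, max_eq_left h'] at h; linarith
        · exact max_eq_right h'.le
      have h1 : L * y ^ d ≤ u + A * y ^ (d - 1) := by
        have : φ.coeff d • z ^ d = polyMap φ z -
            ∑ i ∈ Finset.range d, φ.coeff i • z ^ i := by rw [hsplit]; ring
        rw [hyz, ← htop, this]
        refine ((M.placeAbs w).sub_le_add _ _).trans ?_
        rw [← hyz]
        exact add_le_add (le_max_right _ _) (hlow z)
      have h2 : A ≤ L / 2 * y := by
        have : 2 * A / L ≤ y := (le_max_right _ _).trans h.le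
        rw [div_le_iff₀ hL0] at this
        linarith
      have h3 : y ^ d = y * y ^ (d - 1) := by rw [← pow_succ', Nat.sub_add_cancel hd]
      have h4 : A * y ^ (d - 1) ≤ L / 2 * y ^ d := by
        rw [h3, ← mul_assoc]; gcongr
      have h5 : y ^ d ≤ 2 / L * u := by
        rw [div_mul_eq_mul_div, le_div_iff₀ hL0]; linarith
      have : 0 ≤ B ^ d * u := by positivity
      linarith
  refine ⟨max (1 + A + L) (B ^ d + 2 / L), le_max_of_le_left (by linarith), fun z => ⟨?_, ?_⟩⟩
  · exact (hup z).trans (by gcongr; exact le_max_left _ _)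
  · exact (hdown z).trans (by gcongr; exact le_max_right _ _)

theorem finite_not_goodReduction {φ : K[X]} (hφ : φ ≠ 0) :
    {w | ¬ (IsNonarchimedean (M.absVal w) ∧ M.GoodReduction w φ)}.Finite := by
  refine ((M.finite_not_isNonarchimedean.union (M.finite_coeff_gt_one φ)).union
    (M.finite_ne_one _ (leadingCoeff_ne_zero.mpr hφ))).subset ?_
  intro w hw
  by_contra h
  simp only [Set.mem_union, Set.mem_ofPred_eq, not_or, not_not, not_exists, not_lt] at h
  exact hw ⟨h.1.1, h.1.2, h.2⟩

theorem exists_bound_posLog_polyMap (w : M.Place) {φ : K[X]} (hd : 1 ≤ φ.natDegree) :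
    ∃ C : ℝ, 0 ≤ C ∧ ∀ z, |Real.posLog (M.placeAbs w (polyMap φ z)) -
      φ.natDegree * Real.posLog (M.placeAbs w z)| ≤ C := by
  obtain ⟨C, hC, h⟩ := M.exists_bound_max_polyMap w hd
  refine ⟨Real.log C, Real.log_nonneg hC, fun z => ?_⟩
  have hC0 : C ≠ 0 := by positivity
  have p1 : ∀ x : ℝ, 0 < max 1 x := fun x => lt_max_of_lt_left one_pos
  rw [Real.posLog_eq_log_max_one (by positivity), Real.posLog_eq_log_max_one (by positivity),
    ← Real.log_pow, abs_sub_le_iff]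
  have h1 := Real.log_le_log (p1 _) (h z).1
  have h2 := Real.log_le_log (pow_pos (p1 _) _) (h z).2
  rw [Real.log_mul hC0 (pow_pos (p1 _) _).ne'] at h1
  rw [Real.log_mul hC0 (p1 _).ne'] at h2
  constructor <;> linarith

theorem posLog_polyMap_of_goodReduction {w : M.Place} (hw : IsNonarchimedean (M.absVal w))
    {φ : K[X]} (h : M.GoodReduction w φ) (z : AlgebraicClosure K) :
    Real.posLog (M.placeAbs w (polyMap φ z)) =
      φ.natDegree * Real.posLog (M.placeAbs w z) := by
  rw [Real.posLog_eq_log_max_one (by positivity), Real.posLog_eq_log_max_one (by positivity),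
    ← Real.log_pow, M.max_one_placeAbs_polyMap hw h]

theorem exists_bound_localHeightSum {φ : K[X]} (hd : 1 ≤ φ.natDegree) :
    ∃ C : ℝ, 0 ≤ C ∧ ∀ z,
      |M.localHeightSum (polyMap φ z) - φ.natDegree * M.localHeightSum z| ≤ C := by
  classical
  have hφ : φ ≠ 0 := by rintro rfl; simp at hd
  choose c hc0 hc using fun w => M.exists_bound_posLog_polyMap w hd
  -- At ultrametric places of good reduction the error vanishes, so the local constants have finite
  -- support and can be summed.
  let c' : M.Place → ℝ := fun w =>
    if IsNonarchimedean (M.absVal w) ∧ M.GoodReduction w φ then 0 else c w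
  have hc'fin : c'.support.Finite :=
    (M.finite_not_goodReduction hφ).subset fun w hw h => hw (if_pos h)
  have hc' : ∀ w z, |Real.posLog (M.placeAbs w (polyMap φ z)) -
      φ.natDegree * Real.posLog (M.placeAbs w z)| ≤ c' w := by
    intro w z
    by_cases h : IsNonarchimedean (M.absVal w) ∧ M.GoodReduction w φ
    · rw [M.posLog_polyMap_of_goodReduction h.1 h.2]
      simp [c', h]
    · simp only [c', if_neg h]
      exact hc w z
  refine ⟨M.wsum c', M.wsum_nonneg fun w => ?_, fun z => ?_⟩
  · by_cases h : IsNonarchimedean (M.absVal w) ∧ M.GoodReduction w φ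
    · simp [c', h]
    · simp only [c', if_neg h]
      exact hc0 w
  have s1 := M.support_posLog_placeAbs (polyMap φ z)
  have s2 : (fun w => (φ.natDegree : ℝ) * Real.posLog (M.placeAbs w z)).support.Finite :=
    (M.support_posLog_placeAbs z).subset fun w hw => right_ne_zero_of_mul hw
  have a1 : (fun w => c' w + φ.natDegree * Real.posLog (M.placeAbs w z)).support.Finite :=
    (hc'fin.union s2).subset (Function.support_add _ _)
  have a2 : (fun w => c' w + Real.posLog (M.placeAbs w (polyMap φ z))).support.Finite :=
    (hc'fin.union s1).subset (Function.support_add _ _)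
  have h1 := M.wsum_mono s1 a1 fun w => by
    have := (abs_sub_le_iff.mp (hc' w z)).1
    linarith
  have h2 := M.wsum_mono s2 a2 fun w => by
    have := (abs_sub_le_iff.mp (hc' w z)).2
    linarith
  rw [M.wsum_add hc'fin s2, wsum_const_mul] at h1
  rw [M.wsum_add hc'fin s1, wsum_const_mul] at h2
  rw [abs_sub_le_iff, localHeightSum, localHeightSum]
  constructor <;> linarith

theorem exists_bound_height {φ : K[X]} (hd : 1 ≤ φ.natDegree) :
    ∃ C : ℝ, 0 ≤ C ∧ ∀ α, |M.height (polyMap φ α) - φ.natDegree * M.height α| ≤ C := by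
  obtain ⟨C, hC, h⟩ := M.exists_bound_localHeightSum hd
  refine ⟨C, hC, fun α => ?_⟩
  have h0 := M.height_iterate φ 1 α
  simp only [Function.iterate_one] at h0
  rw [h0, height_eq_conjAvg, ← conjAvg_const_mul, abs_sub_le_iff]
  have h1 := conjAvg_mono (α := α) fun z _ => sub_le_iff_le_add.mp (abs_sub_le_iff.mp (h z)).1
  have h2 := conjAvg_mono (α := α) fun z _ => sub_le_iff_le_add.mp (abs_sub_le_iff.mp (h z)).2
  rw [conjAvg_add, conjAvg_const] at h1 h2
  constructor <;> linarith

/-- Tate's telescoping argument. Convergence is part of the conclusion because `canonicalHeight` is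
a `limUnder`, which means nothing without it; C is uniform in both α and k. -/
theorem exists_bound_canonicalHeight {φ : K[X]} (hd : 2 ≤ φ.natDegree) :
    ∃ C : ℝ, 0 ≤ C ∧ ∀ α,
      Tendsto (fun n : ℕ => M.height ((polyMap φ)^[n] α) / (φ.natDegree : ℝ) ^ n) atTop
        (nhds (M.canonicalHeight φ α)) ∧
      ∀ k : ℕ, |M.height ((polyMap φ)^[k] α) -
        (φ.natDegree : ℝ) ^ k * M.canonicalHeight φ α| ≤ C := by
  obtain ⟨C, hC, h⟩ := M.exists_bound_height (φ := φ) (by omega)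
  refine ⟨C, hC, fun α => ?_⟩
  set d : ℝ := (φ.natDegree : ℝ) with hdd
  have hd2 : 2 ≤ d := by rw [hdd]; exact_mod_cast hd
  have hd0 : 0 < d := by linarith
  set a : ℕ → ℝ := fun n => M.height ((polyMap φ)^[n] α) / d ^ n with ha
  have hstep : ∀ n, dist (a n) (a (n + 1)) ≤ C / d * (1 / d) ^ n := by
    intro n
    have h1 := h ((polyMap φ)^[n] α)
    rw [← Function.iterate_succ_apply' (polyMap φ) n α] at h1
    rw [dist_comm, Real.dist_eq, ha]
    have h2 : M.height ((polyMap φ)^[n + 1] α) / d ^ (n + 1) - M.height ((polyMap φ)^[n] α) / d ^ n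
        = (M.height ((polyMap φ)^[n + 1] α) - d * M.height ((polyMap φ)^[n] α)) / d ^ (n + 1) := by
      field_simp
      ring
    simp only
    rw [h2, abs_div, abs_of_pos (pow_pos hd0 (n + 1)), one_div, inv_pow, ← div_eq_mul_inv,
      div_div, ← pow_succ']
    gcongr
  have hr : 1 / d < 1 := by rw [div_lt_one hd0]; linarith
  have hlim : Tendsto a atTop (nhds (M.canonicalHeight φ α)) :=
    (cauchySeq_of_le_geometric _ _ hr hstep).tendsto_limUnder
  refine ⟨hlim, fun k => ?_⟩
  have h1 := dist_le_of_le_geometric_of_tendsto _ _ hr hstep hlim k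
  have hk : 0 < d ^ k := pow_pos hd0 k
  -- The geometric series contributes 1/(d − 1), which is at most 1 as d ≥ 2, so the one-step
  -- constant C survives.
  have h2 : C / d * (1 / d) ^ k / (1 - 1 / d) ≤ C / d ^ k := by
    have h3 : C / d * (1 / d) ^ k / (1 - 1 / d) = C / d ^ k * (1 / (d - 1)) := by
      have : d - 1 ≠ 0 := by linarith
      rw [one_sub_div hd0.ne', one_div d, inv_pow]
      field_simp
    rw [h3]
    refine mul_le_of_le_one_right (by positivity) ?_
    rw [div_le_one (by linarith)]; linarith
  have h4 : M.height ((polyMap φ)^[k] α) - d ^ k * M.canonicalHeight φ α =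
      d ^ k * (a k - M.canonicalHeight φ α) := by
    simp only [ha]; field_simp
  rw [h4, abs_mul, abs_of_pos hk, ← Real.dist_eq]
  calc _ ≤ d ^ k * (C / d ^ k) := by gcongr; exact h1.trans h2
    _ = C := by field_simp

theorem canonicalHeight_eq_zero_of_isPreperiodic {φ : K[X]} (hd : 2 ≤ φ.natDegree)
    {α : AlgebraicClosure K} (h : IsPreperiodic φ α) : M.canonicalHeight φ α = 0 := by
  obtain ⟨C, -, hC⟩ := M.exists_bound_canonicalHeight hd
  obtain ⟨B, hB⟩ := (h.image M.height).bddAbove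
  refine tendsto_nhds_unique (hC α).1 ?_
  have hd1 : (1 : ℝ) < φ.natDegree := by exact_mod_cast hd
  refine squeeze_zero (fun n => div_nonneg (M.height_nonneg _) (by positivity))
    (g := fun n : ℕ => B / (φ.natDegree : ℝ) ^ n) (fun n => ?_)
    ((tendsto_pow_atTop_atTop_of_one_lt hd1).const_div_atTop B)
  gcongr
  exact hB ⟨_, ⟨n, rfl⟩, rfl⟩

end ProductFormula

/-! ### Determinant bounds and base-d digits. -/

theorem AbsoluteValue.det_le {F : Type*} [Field F] (f : AbsoluteValue F ℝ) {n : ℕ}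
    (A : Matrix (Fin n) (Fin n) F) {T : ℝ} (h : ∀ σ : Equiv.Perm (Fin n),
      ∏ i, f (A (σ i) i) ≤ T) : f A.det ≤ n.factorial * T := by
  rw [Matrix.det_apply]
  refine (f.sum_le _ _).trans ?_
  calc _ ≤ ∑ _σ : Equiv.Perm (Fin n), T := by
        refine Finset.sum_le_sum fun σ _ => ?_
        rcases Int.units_eq_one_or (Equiv.Perm.sign σ) with h1 | h1
        · rw [h1, one_smul, map_prod]; exact h σ
        · rw [h1, Units.neg_smul, one_smul, AbsoluteValue.map_neg, map_prod]; exact h σ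
    _ = _ := by simp [Fintype.card_perm]

theorem IsNonarchimedean.det_le {F : Type*} [Field F] {f : AbsoluteValue F ℝ}
    (hf : IsNonarchimedean f) {n : ℕ} (A : Matrix (Fin n) (Fin n) F) {T : ℝ}
    (h : ∀ σ : Equiv.Perm (Fin n), ∏ i, f (A (σ i) i) ≤ T) : f A.det ≤ T := by
  rw [Matrix.det_apply]
  obtain ⟨σ, -, hle⟩ := hf.finset_image_add_of_nonempty
    (fun σ : Equiv.Perm (Fin n) => Equiv.Perm.sign σ • ∏ i, A (σ i) i)
    (t := Finset.univ) Finset.univ_nonempty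
  refine hle.trans ?_
  rcases Int.units_eq_one_or (Equiv.Perm.sign σ) with h1 | h1
  · rw [h1, one_smul, map_prod]; exact h σ
  · rw [h1, Units.neg_smul, one_smul, AbsoluteValue.map_neg, map_prod]; exact h σ

/-- Dividing each column by its leading coefficient reduces to monic polynomials, for which the
change of basis is unipotent. -/
theorem Matrix.det_eval_eq_prod_leadingCoeff_mul {F : Type*} [Field F] {n : ℕ} (z : Fin n → F)
    (p : Fin n → F[X]) (hp : ∀ j, p j ≠ 0) (hd : ∀ j, (p j).natDegree = j) :
    (Matrix.of fun i j => (p j).eval (z i)).det =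
      (∏ j, (p j).leadingCoeff) * (Matrix.vandermonde z).det := by
  have hl : ∀ j, (p j).leadingCoeff ≠ 0 := fun j => leadingCoeff_ne_zero.mpr (hp j)
  rw [Matrix.det_eval_matrixOfPolynomials_eq_det_vandermonde z
    (fun j => C (p j).leadingCoeff⁻¹ * p j)
    (fun j => by rw [natDegree_C_mul (inv_ne_zero (hl j)), hd])
    (fun j => monic_C_mul_of_mul_leadingCoeff_eq_one (inv_mul_cancel₀ (hl j))),
    ← Matrix.det_mul_row]
  congr 1
  ext i j
  simp only [Matrix.of_apply, eval_mul, eval_C]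
  rw [mul_inv_cancel_left₀ (hl j)]

theorem Nat.sum_digit_mul_pow (d j L : ℕ) :
    ∑ k ∈ Finset.range L, j / d ^ k % d * d ^ k = j % d ^ L := by
  induction L with
  | zero => simp [Nat.mod_one]
  | succ L ih => rw [Finset.sum_range_succ, ih, Nat.mod_pow_succ, mul_comm]

/-- Maximum over `j ≤ m` of the `k`-th digit of `j` in base `d`. -/
def maxDigit (d m k : ℕ) : ℕ := min (m / d ^ k) (d - 1)

theorem digit_le_maxDigit {d j m : ℕ} (hd : 2 ≤ d) (h : j ≤ m) (k : ℕ) :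
    j / d ^ k % d ≤ maxDigit d m k :=
  le_min ((Nat.mod_le _ _).trans (Nat.div_le_div_right h))
    (Nat.le_sub_one_of_lt (Nat.mod_lt _ (by omega)))

theorem le_sum_maxDigit {d m : ℕ} (hd : 2 ≤ d) :
    m ≤ ∑ k ∈ Finset.range (Nat.log d m + 1), maxDigit d m k * d ^ k := by
  have h := Nat.sum_digit_mul_pow d m (Nat.log d m + 1)
  rw [Nat.mod_eq_of_lt (Nat.lt_pow_succ_log_self (by omega) m)] at h
  conv_lhs => rw [← h]
  exact Finset.sum_le_sum fun k _ => Nat.mul_le_mul_right _ (digit_le_maxDigit hd le_rfl k)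

/-- The top digit contributes at most m; the lower ones together contribute less than d^(log_d m),
again at most m. The factor 2 is the price of using one bound for all j ≤ m. -/
theorem sum_maxDigit_le {d m : ℕ} (hd : 2 ≤ d) :
    ∑ k ∈ Finset.range (Nat.log d m + 1), maxDigit d m k * d ^ k ≤ 2 * m := by
  rcases Nat.eq_zero_or_pos m with rfl | hm
  · simp [maxDigit]
  rw [Finset.sum_range_succ]
  have h1 : maxDigit d m (Nat.log d m) * d ^ Nat.log d m ≤ m :=
    (Nat.mul_le_mul_right _ (min_le_left _ _)).trans (Nat.div_mul_le_self _ _)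
  have h2 : ∀ L, ∑ k ∈ Finset.range L, maxDigit d m k * d ^ k ≤ d ^ L - 1 := by
    intro L
    induction L with
    | zero => simp
    | succ L ih =>
      rw [Finset.sum_range_succ]
      have h3 : maxDigit d m L * d ^ L ≤ (d - 1) * d ^ L :=
        Nat.mul_le_mul_right _ (min_le_right _ _)
      have h4 : d ^ (L + 1) = (d - 1) * d ^ L + d ^ L := by
        rw [← Nat.succ_mul, pow_succ', Nat.succ_eq_add_one, Nat.sub_add_cancel (by omega)]
      have h5 : 0 < d ^ L := by positivity
      omega
  have h3 := h2 (Nat.log d m)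
  have h4 : d ^ Nat.log d m ≤ m := Nat.pow_log_le_self d hm.ne'
  omega

theorem sum_maxDigit_le_log {d m : ℕ} (hd : 2 ≤ d) :
    ∑ k ∈ Finset.range (Nat.log d m + 1), maxDigit d m k ≤ d * (Nat.log 2 m + 1) := by
  calc _ ≤ ∑ _k ∈ Finset.range (Nat.log d m + 1), d :=
        Finset.sum_le_sum fun k _ => (min_le_right _ _).trans (Nat.sub_le _ _)
    _ = (Nat.log d m + 1) * d := by simp
    _ ≤ _ := by
      rw [mul_comm]
      exact Nat.mul_le_mul_left _ (Nat.succ_le_succ (Nat.log_anti_left (by omega) hd))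

/-! ### The Vandermonde determinant of the conjugates and its global estimate. -/

namespace ProductFormula

variable {K : Type*} [Field K] (M : ProductFormula K)

theorem aeval_iterate_comp (φ : K[X]) (k : ℕ) (z : AlgebraicClosure K) :
    aeval z (φ.comp^[k] X) = (polyMap φ)^[k] z := by
  induction k with
  | zero => simp
  | succ k ih => rw [Function.iterate_succ_apply', Function.iterate_succ_apply', aeval_comp, ih,
      polyMap]

theorem absVal_leadingCoeff_iterate_comp {v : M.Place} {φ : K[X]} (hd : φ.natDegree ≠ 0)
    (h : M.absVal v φ.leadingCoeff = 1) (k : ℕ) :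
    M.absVal v (φ.comp^[k] X).leadingCoeff = 1 := by
  induction k with
  | zero => simp
  | succ k ih =>
    rw [Function.iterate_succ_apply', leadingCoeff_comp, map_mul, map_pow, ih, h, one_pow, mul_one]
    rw [natDegree_iterate_comp, natDegree_X, mul_one]
    exact pow_ne_zero _ hd

/-- The polynomial of degree `j` obtained by multiplying iterates of `φ` according to the digits
of `j` in base `deg φ`. -/
noncomputable def digitPoly (φ : K[X]) (L j : ℕ) : K[X] :=
  ∏ k ∈ Finset.range L, (φ.comp^[k] X) ^ (j / φ.natDegree ^ k % φ.natDegree)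

theorem iterate_comp_ne_zero {φ : K[X]} (hd : φ.natDegree ≠ 0) (k : ℕ) :
    φ.comp^[k] X ≠ 0 := by
  intro h
  have := natDegree_iterate_comp (p := φ) (q := X) k
  rw [h, natDegree_zero, natDegree_X, mul_one] at this
  exact pow_ne_zero _ hd this.symm

theorem digitPoly_ne_zero {φ : K[X]} (hd : φ.natDegree ≠ 0) (L j : ℕ) : digitPoly φ L j ≠ 0 :=
  Finset.prod_ne_zero_iff.mpr fun k _ => pow_ne_zero _ (iterate_comp_ne_zero hd k)

theorem natDegree_digitPoly {φ : K[X]} (hd : φ.natDegree ≠ 0) {L j : ℕ}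
    (hj : j < φ.natDegree ^ L) : (digitPoly φ L j).natDegree = j := by
  rw [digitPoly, natDegree_prod _ _ fun k _ => pow_ne_zero _ (iterate_comp_ne_zero hd k)]
  simp only [natDegree_pow, natDegree_iterate_comp, natDegree_X, mul_one]
  rw [Nat.sum_digit_mul_pow, Nat.mod_eq_of_lt hj]

theorem absVal_leadingCoeff_digitPoly {v : M.Place} {φ : K[X]} (hd : φ.natDegree ≠ 0)
    (h : M.absVal v φ.leadingCoeff = 1) (L j : ℕ) :
    M.absVal v (digitPoly φ L j).leadingCoeff = 1 := by
  rw [digitPoly, leadingCoeff_prod, map_prod]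
  refine Finset.prod_eq_one fun k _ => ?_
  rw [leadingCoeff_pow, map_pow, M.absVal_leadingCoeff_iterate_comp hd h, one_pow]

/-- Taking maximal digits makes the bound independent of j. In the determinant it then depends on
the row alone, so every permutation gives the same product. -/
theorem placeAbs_digitPoly_le (w : M.Place) {φ : K[X]} (hd : 2 ≤ φ.natDegree) (L : ℕ) {j m : ℕ}
    (hj : j ≤ m) (z : AlgebraicClosure K) :
    M.placeAbs w (aeval z (digitPoly φ L j)) ≤ Real.exp (∑ k ∈ Finset.range L,
      maxDigit φ.natDegree m k * Real.posLog (M.placeAbs w ((polyMap φ)^[k] z))) := by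
  rw [digitPoly, map_prod, map_prod, Real.exp_sum]
  refine Finset.prod_le_prod (fun k _ => by positivity) fun k _ => ?_
  rw [map_pow, map_pow, aeval_iterate_comp, Real.exp_nat_mul,
    Real.posLog_eq_log_max_one (by positivity), Real.exp_log (lt_max_of_lt_left one_pos)]
  calc _ ≤ (max 1 (M.placeAbs w ((polyMap φ)^[k] z))) ^ (j / φ.natDegree ^ k % φ.natDegree) := by
        gcongr; exact le_max_right _ _
    _ ≤ _ := pow_le_pow_right₀ (le_max_left _ _) (digit_le_maxDigit hd hj k)

/-- An enumeration of the conjugates of `α`. -/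
noncomputable def conjEnum (α : AlgebraicClosure K) (i : Fin (conjugates α).card) :
    AlgebraicClosure K :=
  (conjugates α).equivFin.symm i

theorem conjEnum_mem (α : AlgebraicClosure K) (i : Fin (conjugates α).card) :
    conjEnum α i ∈ conjugates α := Subtype.property _

theorem conjEnum_injective (α : AlgebraicClosure K) : Function.Injective (conjEnum α) :=
  Subtype.val_injective.comp (Equiv.injective _)

theorem sum_conjEnum (α : AlgebraicClosure K) (G : AlgebraicClosure K → ℝ) :
    ∑ i, G (conjEnum α i) = (conjugates α).card * conjAvg α G := by
  rw [← sum_conjugates_eq, ← Finset.sum_coe_sort (conjugates α)]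
  exact Equiv.sum_comp (conjugates α).equivFin.symm (fun z => G z)

/-- The Vandermonde determinant of the conjugates of `α`. -/
noncomputable def conjVandermonde (α : AlgebraicClosure K) : AlgebraicClosure K :=
  (Matrix.vandermonde (conjEnum α)).det

theorem conjVandermonde_ne_zero (α : AlgebraicClosure K) : conjVandermonde α ≠ 0 :=
  Matrix.det_vandermonde_ne_zero_iff.mpr (conjEnum_injective α)

/-- An automorphism permutes the rows, so it can change V by a sign; only the square is invariant.
-/
theorem map_conjVandermonde_sq (α : AlgebraicClosure K)
    (σ : AlgebraicClosure K ≃ₐ[K] AlgebraicClosure K) :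
    σ (conjVandermonde α ^ 2) = conjVandermonde α ^ 2 := by
  have hmem : ∀ i, σ (conjEnum α i) ∈ conjugates α := by
    intro i
    obtain ⟨τ, hτ⟩ := mem_conjugates_iff.mp (conjEnum_mem α i)
    exact mem_conjugates_iff.mpr ⟨τ.trans σ, by rw [← hτ]; rfl⟩
  let π₀ : Fin (conjugates α).card → Fin (conjugates α).card := fun i =>
    (conjugates α).equivFin ⟨_, hmem i⟩
  have hπ₀ : ∀ i, conjEnum α (π₀ i) = σ (conjEnum α i) := fun i => by
    simp [conjEnum, π₀]
  have hinj : Function.Injective π₀ := fun i j h => by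
    apply conjEnum_injective α
    apply σ.injective
    rw [← hπ₀, ← hπ₀, h]
  let π : Equiv.Perm (Fin (conjugates α).card) :=
    Equiv.ofBijective π₀ (Finite.injective_iff_bijective.mp hinj)
  have h1 : σ (conjVandermonde α) =
      ((Matrix.vandermonde (conjEnum α)).submatrix π id).det := by
    rw [conjVandermonde, AlgEquiv.map_det]
    congr 1
    ext i j
    simp only [AlgEquiv.mapMatrix_apply, Matrix.map_apply, Matrix.vandermonde_apply,
      Matrix.submatrix_apply, id, map_pow]
    rw [← hπ₀]
    rfl
  rw [map_pow, h1, Matrix.det_permute, mul_pow, ← conjVandermonde]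
  rcases Int.units_eq_one_or (Equiv.Perm.sign π) with h | h <;> simp [h]

theorem wsum_log_conjVandermonde (α : AlgebraicClosure K) :
    M.wsum (fun w => Real.log (M.placeAbs w (conjVandermonde α))) = 0 := by
  have := M.wsum_log_placeAbs_of_fixed (pow_ne_zero 2 (conjVandermonde_ne_zero α))
    (map_conjVandermonde_sq α)
  simp only [map_pow, Real.log_pow] at this
  rw [wsum_const_mul] at this
  simpa using this

open Classical in
/-- Total weight of the archimedean places. -/
noncomputable def archWeight : ℝ :=
  M.wsum (fun w => if IsNonarchimedean (M.absVal w) then 0 else 1)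

open Classical in
-- The determinant in the `digitPoly` basis is expanded over permutations, each product being
-- bounded by the same row factors. The number n! of terms matters only at archimedean places.
theorem log_conjVandermonde_le (w : M.Place) {φ : K[X]} (hd : 2 ≤ φ.natDegree)
    (α : AlgebraicClosure K) {L : ℕ} (hL : (conjugates α).card - 1 < φ.natDegree ^ L) :
    Real.log (M.placeAbs w (conjVandermonde α)) +
      ∑ j : Fin (conjugates α).card, Real.log (M.absVal w (digitPoly φ L j).leadingCoeff) ≤
    Real.log (conjugates α).card.factorial *
        (if IsNonarchimedean (M.absVal w) then 0 else 1) +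
      ∑ i, ∑ k ∈ Finset.range L, maxDigit φ.natDegree ((conjugates α).card - 1) k *
        Real.posLog (M.placeAbs w ((polyMap φ)^[k] (conjEnum α i))) := by
  have hd0 : φ.natDegree ≠ 0 := by omega
  set n := (conjugates α).card with hn
  set z := conjEnum α
  let ι := algebraMap K (AlgebraicClosure K)
  have hjn : ∀ j : Fin n, (j : ℕ) ≤ n - 1 := fun j => by omega
  have hdet := Matrix.det_eval_eq_prod_leadingCoeff_mul z (fun j => (digitPoly φ L j).map ι)
    (fun j => (Polynomial.map_ne_zero_iff ι.injective).mpr (digitPoly_ne_zero hd0 L j))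
    (fun j => by rw [natDegree_map, natDegree_digitPoly hd0 ((hjn j).trans_lt hL)])
  set A := (Matrix.of fun i j : Fin n => ((digitPoly φ L j).map ι).eval (z i)) with hA
  set T : Fin n → ℝ := fun i => ∑ k ∈ Finset.range L, maxDigit φ.natDegree (n - 1) k *
        Real.posLog (M.placeAbs w ((polyMap φ)^[k] (z i))) with hT
  have hperm : ∀ σ : Equiv.Perm (Fin n), ∏ i, M.placeAbs w (A (σ i) i) ≤
      Real.exp (∑ i, T i) := by
    intro σ
    rw [← Equiv.sum_comp σ, Real.exp_sum]
    refine Finset.prod_le_prod (fun i _ => by positivity) fun i _ => ?_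
    simp only [hA, Matrix.of_apply]
    rw [eval_map_algebraMap]
    exact M.placeAbs_digitPoly_le w hd L (hjn i) _
  have hlog : Real.log (M.placeAbs w A.det) = Real.log (M.placeAbs w (conjVandermonde α)) +
      ∑ j : Fin n, Real.log (M.absVal w (digitPoly φ L j).leadingCoeff) := by
    have hl : ∀ j : Fin n, M.absVal w (digitPoly φ L j).leadingCoeff ≠ 0 := fun j =>
      (M.absVal w).ne_zero (leadingCoeff_ne_zero.mpr (digitPoly_ne_zero hd0 L j))
    rw [hdet, map_mul, map_prod, ← conjVandermonde]
    simp only [leadingCoeff_map, ι, placeAbs_algebraMap]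
    rw [Real.log_mul (Finset.prod_ne_zero_iff.mpr fun j _ => hl j)
      ((M.placeAbs w).ne_zero (conjVandermonde_ne_zero α)), Real.log_prod fun j _ => hl j, add_comm]
  have hA0 : A.det ≠ 0 := by
    rw [hdet]
    exact mul_ne_zero (Finset.prod_ne_zero_iff.mpr fun j _ => leadingCoeff_ne_zero.mpr
      ((Polynomial.map_ne_zero_iff ι.injective).mpr (digitPoly_ne_zero hd0 L j)))
      (conjVandermonde_ne_zero α)
  rw [← hlog]
  split_ifs with hw
  · rw [mul_zero, zero_add, Real.log_le_iff_le_exp ((M.placeAbs w).pos hA0)]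
    exact (M.placeAbs_isNonarchimedean hw).det_le A hperm
  · rw [mul_one, Real.log_le_iff_le_exp ((M.placeAbs w).pos hA0), Real.exp_add,
      Real.exp_log (by positivity)]
    exact (M.placeAbs w).det_le A hperm

theorem posLog_iterate_of_goodReduction {v : M.Place} (hv : IsNonarchimedean (M.absVal v))
    {φ : K[X]} (h : M.GoodReduction v φ) (k : ℕ) (z : AlgebraicClosure K) :
    Real.posLog (M.placeAbs v ((polyMap φ)^[k] z)) =
      φ.natDegree ^ k * Real.posLog (M.placeAbs v z) := by
  induction k with
  | zero => simp
  | succ k ih =>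
    rw [Function.iterate_succ_apply', M.posLog_polyMap_of_goodReduction hv h, ih]
    ring

/-- Global consequence of a gain `δ` in the local bound for the Vandermonde determinant of the
conjugates at a place of good reduction. -/
theorem weight_mul_gain_le {v : M.Place} (hv : IsNonarchimedean (M.absVal v))
    {φ : K[X]} (hd : 2 ≤ φ.natDegree) (h : M.GoodReduction v φ) (α : AlgebraicClosure K) {δ : ℝ}
    (hδ : Real.log (M.placeAbs v (conjVandermonde α)) + δ ≤
      ∑ i, ((conjugates α).card - 1 : ℕ) * Real.posLog (M.placeAbs v (conjEnum α i))) :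
    M.weight v * δ ≤ Real.log (conjugates α).card.factorial * M.archWeight +
      (conjugates α).card * ∑ k ∈ Finset.range (Nat.log φ.natDegree ((conjugates α).card - 1) + 1),
        maxDigit φ.natDegree ((conjugates α).card - 1) k * M.height ((polyMap φ)^[k] α) := by
  classical
  have hd0 : φ.natDegree ≠ 0 := by omega
  set n := (conjugates α).card with hn
  set L := Nat.log φ.natDegree (n - 1) + 1 with hL
  have hLn : n - 1 < φ.natDegree ^ L := Nat.lt_pow_succ_log_self (by omega) _
  set c := maxDigit φ.natDegree (n - 1) with hc
  let a : M.Place → ℝ := fun w => Real.log (M.placeAbs w (conjVandermonde α))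
  let b : Fin n → M.Place → ℝ := fun j w => Real.log (M.absVal w (digitPoly φ L j).leadingCoeff)
  let s : M.Place → ℝ := fun w => if w = v then δ else 0
  let u : M.Place → ℝ := fun w => if IsNonarchimedean (M.absVal w) then 0 else 1
  let t : Fin n → ℕ → M.Place → ℝ := fun i k w =>
    c k * Real.posLog (M.placeAbs w ((polyMap φ)^[k] (conjEnum α i)))
  have hlc : ∀ j, (digitPoly φ L j).leadingCoeff ≠ 0 := fun j =>
    leadingCoeff_ne_zero.mpr (digitPoly_ne_zero hd0 L j)
  have ha : a.support.Finite := M.support_log_placeAbs _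
  have hb : ∀ j ∈ Finset.univ, (b j).support.Finite := fun j _ =>
    (M.finite_ne_one _ (hlc j)).subset fun w hw h1 => hw (by simp [b, h1])
  have hs : s.support.Finite := (Set.finite_singleton v).subset fun w hw => by
    by_contra h1
    exact hw (if_neg h1)
  have hu : u.support.Finite := M.finite_not_isNonarchimedean.subset fun w hw h1 => hw (if_pos h1)
  have hu' : (fun w => Real.log n.factorial * u w).support.Finite :=
    hu.subset fun w hw => right_ne_zero_of_mul hw
  have ht : ∀ i, ∀ k ∈ Finset.range L, (t i k).support.Finite := fun i k _ =>
    (M.support_posLog_placeAbs _).subset fun w hw => right_ne_zero_of_mul hw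
  have hst : ∀ i ∈ Finset.univ, (fun w => ∑ k ∈ Finset.range L, t i k w).support.Finite :=
    fun i _ => M.support_sum_finite (ht i)
  have hB := M.support_sum_finite hb
  have hT := M.support_sum_finite hst
  have hAB : (fun w => a w + ∑ j, b j w).support.Finite :=
    (ha.union hB).subset (Function.support_add _ _)
  have hlocal : ∀ w, (a w + ∑ j, b j w) + s w ≤
      Real.log n.factorial * u w + ∑ i, ∑ k ∈ Finset.range L, t i k w := by
    intro w
    by_cases hw : w = v
    · subst hw
      -- At v the leading coefficients are units, so the sharper bound `hδ`, obtained in another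
      -- basis, may replace the `digitPoly` bound.
      have hb0 : ∑ j, b j w = 0 := Finset.sum_eq_zero fun j _ => by
        simp only [b, M.absVal_leadingCoeff_digitPoly hd0 h.2, Real.log_one]
      simp only [s, if_true, hb0, u, if_pos hv, mul_zero, zero_add, add_zero]
      -- Good reduction gives log⁺|φ^k(z)| = d^k·log⁺|z|, and ∑ c_k d^k ≥ n − 1. So the right side
      -- at v has the same shape as at the other places and global heights appear.
      refine hδ.trans (Finset.sum_le_sum fun i _ => ?_)
      simp only [t, M.posLog_iterate_of_goodReduction hv h, ← mul_assoc]
      rw [← Finset.sum_mul]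
      refine mul_le_mul_of_nonneg_right ?_ Real.posLog_nonneg
      exact_mod_cast le_sum_maxDigit (m := n - 1) hd
    · simp only [s, if_neg hw, add_zero]
      exact M.log_conjVandermonde_le w hd α hLn
  have key := M.wsum_mono ((hAB.union hs).subset (Function.support_add _ _))
    ((hu'.union hT).subset (Function.support_add _ _)) hlocal
  rw [M.wsum_add hAB hs, M.wsum_add ha hB, M.wsum_sum _ hb, M.wsum_add hu' hT, M.wsum_sum _ hst,
    wsum_single, wsum_const_mul, M.wsum_log_conjVandermonde,
    Finset.sum_eq_zero fun j _ => M.wsum_log_absVal (hlc _), zero_add, zero_add] at key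
  refine key.trans (le_of_eq ?_)
  congr 1
  rw [Finset.sum_congr rfl fun i _ => M.wsum_sum _ (ht i), Finset.sum_comm, Finset.mul_sum]
  refine Finset.sum_congr rfl fun k _ => ?_
  simp only [t, wsum_const_mul]
  rw [← Finset.mul_sum, height_iterate, mul_left_comm, ← sum_conjEnum]
  rfl

end ProductFormula

/-! ### Ramification index and residue degree of finite extensions. -/

section Extensions

variable (k : Type*) {F : Type*} [Field k] [Field F] [Algebra k F] (w : Valuation F ℝ≥0)

/-- Dividing a relation by its coefficient of largest value makes it integral with one coefficient
equal to 1, so its reduction is still nontrivial. -/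
theorem linearIndependent_of_residue {ι : Type*} [Fintype ι] (x : ι → w.valuationSubring)
    (hx : LinearIndependent (IsLocalRing.ResidueField (w.comap (algebraMap k F)).valuationSubring)
      (fun i => IsLocalRing.residue w.valuationSubring (x i))) :
    LinearIndependent k (fun i => (x i : F)) := by
  classical
  rw [Fintype.linearIndependent_iff]
  by_contra! h
  obtain ⟨g, hg, i₁, hi₁⟩ := h
  obtain ⟨i₀, -, hmax⟩ := Finset.exists_max_image Finset.univ
    (fun i => w (algebraMap k F (g i))) ⟨i₁, Finset.mem_univ _⟩
  have hg0 : g i₀ ≠ 0 := by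
    intro h0
    have := hmax i₁ (Finset.mem_univ _)
    rw [h0, map_zero, map_zero, nonpos_iff_eq_zero, map_eq_zero, map_eq_zero] at this
    exact hi₁ this
  have hle : ∀ i, g i / g i₀ ∈ (w.comap (algebraMap k F)).valuationSubring := by
    intro i
    rw [Valuation.mem_valuationSubring_iff, Valuation.comap_apply, map_div₀, map_div₀]
    exact div_le_one_of_le₀ (hmax i (Finset.mem_univ _)) zero_le
  let c : ι → (w.comap (algebraMap k F)).valuationSubring := fun i => ⟨g i / g i₀, hle i⟩
  have hsum : ∑ i, algebraMap _ w.valuationSubring (c i) * x i = 0 := by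
    apply Subtype.ext
    push_cast
    have : ∀ i, ((algebraMap _ w.valuationSubring (c i) : w.valuationSubring) : F) * x i =
        (algebraMap k F (g i₀))⁻¹ * (g i • (x i : F)) := by
      intro i
      rw [Valuation.HasExtension.coe_algebraMap_valuationSubring_eq, map_div₀, Algebra.smul_def]
      ring
    rw [Finset.sum_congr rfl fun i _ => this i, ← Finset.mul_sum, hg, mul_zero]
  have hres := congrArg (IsLocalRing.residue w.valuationSubring) hsum
  rw [map_sum, map_zero] at hres
  have h0 := Fintype.linearIndependent_iff.mp hx (fun i => IsLocalRing.residue _ (c i)) (by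
    rw [← hres]
    refine Finset.sum_congr rfl fun i _ => ?_
    rw [Algebra.smul_def, map_mul, Valuation.HasExtension.algebraMap_residue_eq_residue_algebraMap])
    i₀
  have h1 : c i₀ = 1 := Subtype.ext (div_self hg0)
  rw [h1, map_one] at h0
  exact one_ne_zero h0

/-- `residueDegree` is a `finrank`, which is 0 for infinite extensions. Finiteness is what gives an
upper bound on it any content. -/
theorem finite_residueField_extension [FiniteDimensional k F] :
    Module.Finite (IsLocalRing.ResidueField (w.comap (algebraMap k F)).valuationSubring)
      (IsLocalRing.ResidueField w.valuationSubring) := by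
  rw [← Module.rank_lt_aleph0_iff]
  refine (rank_le (n := Module.finrank k F) fun s hs => ?_).trans_lt (Cardinal.natCast_lt_aleph0)
  choose x hx using IsLocalRing.residue_surjective (R := w.valuationSubring)
  have := (linearIndependent_of_residue k w (fun i : s => x i) (by
    simp only [hx]; exact hs)).fintype_card_le_finrank
  simpa using this

theorem linearIndependent_of_value_ne {ι : Type*} [Fintype ι] (x : ι → F) (hx0 : ∀ i, x i ≠ 0)
    (hx : ∀ i j, i ≠ j → ∀ a b : k, a ≠ 0 → b ≠ 0 →
      w (algebraMap k F a * x i) ≠ w (algebraMap k F b * x j)) :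
    LinearIndependent k x := by
  classical
  rw [Fintype.linearIndependent_iff]
  by_contra! h
  obtain ⟨g, hg, i₁, hi₁⟩ := h
  obtain ⟨i₀, -, hmax⟩ := Finset.exists_max_image Finset.univ
    (fun i => w (algebraMap k F (g i) * x i)) ⟨i₁, Finset.mem_univ _⟩
  have hpos : 0 < w (algebraMap k F (g i₀) * x i₀) := by
    refine lt_of_lt_of_le ?_ (hmax i₁ (Finset.mem_univ _))
    rw [pos_iff_ne_zero, Valuation.ne_zero_iff]
    exact mul_ne_zero (by simpa using hi₁) (hx0 _)
  have hg0 : g i₀ ≠ 0 := by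
    intro h0
    simp [h0] at hpos
  have hlt : ∀ i ∈ Finset.univ \ {i₀}, w (algebraMap k F (g i) * x i) <
      w (algebraMap k F (g i₀) * x i₀) := by
    intro i hi
    have hne : i ≠ i₀ := by simpa using hi
    refine lt_of_le_of_ne (hmax i (Finset.mem_univ _)) ?_
    by_cases hgi : g i = 0
    · rw [hgi]; simpa using hpos.ne
    · exact hx i i₀ hne _ _ hgi hg0
  have hsum := w.map_sum_eq_of_lt (f := fun i => algebraMap k F (g i) * x i)
    (Finset.mem_univ i₀) hlt
  simp only [← Algebra.smul_def] at hsum hpos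
  rw [hg, map_zero] at hsum
  exact hpos.ne hsum

/-- The value 0 would stand for infinite index. It is excluded because representatives of distinct
cosets of the value group are linearly independent: in a relation the term of largest value would be
unique. -/
theorem ramificationIndex_ne_zero [FiniteDimensional k F] : ramificationIndex k w ≠ 0 := by
  classical
  intro h
  set H := (Units.map (w.comap (algebraMap k F) : k →* ℝ≥0)).range
  set G := (Units.map (w : F →* ℝ≥0)).range
  have hinf : Infinite (G ⧸ H.subgroupOf G) := by
    rw [← Subgroup.index_eq_zero_iff_infinite]; exact h
  obtain ⟨s, hs⟩ := Infinite.exists_subset_card_eq (G ⧸ H.subgroupOf G) (Module.finrank k F + 1)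
  have hG : ∀ q : G ⧸ H.subgroupOf G, ∃ u : Fˣ, ∃ hu : Units.map (w : F →* ℝ≥0) u ∈ G,
      QuotientGroup.mk (⟨_, hu⟩ : G) = q := by
    intro q
    obtain ⟨⟨_, u, rfl⟩, rfl⟩ := QuotientGroup.mk_surjective q
    exact ⟨u, _, rfl⟩
  choose u hu hq using hG
  have hli := linearIndependent_of_value_ne k w (fun q : s => (u q : F)) (fun q => (u q).ne_zero)
    (by
      intro p q hpq a b ha hb heq
      apply hpq
      apply Subtype.ext
      rw [← hq p, ← hq q, QuotientGroup.eq, Subgroup.mem_subgroupOf]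
      refine ⟨Units.mk0 a ha * (Units.mk0 b hb)⁻¹, ?_⟩
      apply Units.ext
      have hwb : w (algebraMap k F b) ≠ 0 := by
        rw [Valuation.ne_zero_iff]; simpa using hb
      have hwp : w (u p : F) ≠ 0 := by
        rw [Valuation.ne_zero_iff]; exact (u p).ne_zero
      rw [map_mul, map_mul] at heq
      simp only [map_mul, map_inv, Units.val_mul, Units.val_inv_eq_inv_val, Units.coe_map,
        Units.val_mk0, Subgroup.coe_mul, Subgroup.coe_inv, MonoidHom.coe_coe,
        Valuation.comap_apply]
      field_simp
      exact heq)
  have := hli.fintype_card_le_finrank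
  rw [Fintype.card_coe, hs] at this
  omega

/-- Raising w x to the ramification index lands in the value group of k, where the gap ρ is
available. -/
theorem pow_le_of_ramificationIndex_le [FiniteDimensional k F] {e : ℕ}
    (he : ramificationIndex k w ≤ e) {ρ : ℝ≥0}
    (hρ : ∀ y : k, w (algebraMap k F y) < 1 → w (algebraMap k F y) ≤ ρ) {x : F} (hx : w x < 1) :
    w x ^ e ≤ ρ := by
  by_cases hx0 : x = 0
  · have : 0 < e := (Nat.pos_of_ne_zero (ramificationIndex_ne_zero k w)).trans_le he
    rw [hx0, map_zero, zero_pow this.ne']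
    exact zero_le
  refine (pow_le_pow_of_le_one zero_le hx.le he).trans ?_
  obtain ⟨y, hy⟩ := Subgroup.pow_relIndex_mem
    (Units.map (w.comap (algebraMap k F) : k →* ℝ≥0)).range
    (K := (Units.map (w : F →* ℝ≥0)).range) (g := Units.map (w : F →* ℝ≥0) (Units.mk0 x hx0))
    ⟨_, rfl⟩
  have hy' : w (algebraMap k F y) = w x ^ ramificationIndex k w := by
    have := congrArg Units.val hy
    simpa using! this
  rw [← hy']
  apply hρ
  rw [hy']
  exact pow_lt_one₀ zero_le hx (ramificationIndex_ne_zero k w)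

theorem exists_sub_lt_one_of_residueDegree_le [FiniteDimensional k F] {f q : ℕ}
    (hf : residueDegree k w ≤ f)
    (hfin : Finite (IsLocalRing.ResidueField (w.comap (algebraMap k F)).valuationSubring))
    (hq : Nat.card (IsLocalRing.ResidueField (w.comap (algebraMap k F)).valuationSubring) ≤ q)
    {ι : Type*} [Fintype ι] (hι : q ^ f < Fintype.card ι) (y : ι → F) (hy : ∀ i, w (y i) ≤ 1) :
    ∃ i j, i ≠ j ∧ w (y i - y j) < 1 := by
  have := finite_residueField_extension k w
  have hfin' : Finite (IsLocalRing.ResidueField w.valuationSubring) :=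
    Module.finite_of_finite
      (IsLocalRing.ResidueField (w.comap (algebraMap k F)).valuationSubring)
  have hcard : Nat.card (IsLocalRing.ResidueField w.valuationSubring) ≤ q ^ f := by
    rw [Module.natCard_eq_pow_finrank
      (K := IsLocalRing.ResidueField (w.comap (algebraMap k F)).valuationSubring)]
    calc _ ≤ q ^ residueDegree k w := Nat.pow_le_pow_left hq _
      _ ≤ q ^ f := Nat.pow_le_pow_right (Nat.card_pos.trans_le hq) hf
  have : Fintype (IsLocalRing.ResidueField w.valuationSubring) := Fintype.ofFinite _
  rw [Nat.card_eq_fintype_card] at hcard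
  obtain ⟨i, j, hij, h⟩ := Fintype.exists_ne_map_eq_of_card_lt
    (fun i => IsLocalRing.residue w.valuationSubring ⟨y i, hy i⟩) (hcard.trans_lt hι)
  refine ⟨i, j, hij, ?_⟩
  rw [← sub_eq_zero, ← map_sub, IsLocalRing.residue_eq_zero_iff,
    Valuation.mem_maximalIdeal_iff] at h
  exact h

end Extensions

/-! ### Value gaps and the gain at v. -/

/-- The subfield `E` has value gap `ρ` below `1` and at most `N` residue classes with respect to
the absolute value `g`. -/
structure HasValueGap {K L : Type*} [Field K] [Field L] [Algebra K L] (g : AbsoluteValue L ℝ)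
    (E : IntermediateField K L) (N : ℕ) (ρ : ℝ) : Prop where
  le_of_lt_one : ∀ x ∈ E, g x < 1 → g x ≤ ρ
  exists_sub_lt_one : ∀ y : Fin (N + 1) → L, (∀ i, y i ∈ E) → (∀ i, g (y i) ≤ 1) →
    ∃ i j, i ≠ j ∧ g (y i - y j) < 1

namespace HasValueGap

variable {K L : Type*} [Field K] [Field L] [Algebra K L] {g : AbsoluteValue L ℝ}
  {E : IntermediateField K L} {N : ℕ} {ρ : ℝ}

/-- A substitute for x^q ≡ x that needs only a bound on the number of residue classes. For a unit x,
two of 1, x, …, x^N are congruent, so x has residual order at most N, which divides N!. -/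
theorem pow_sub_self_le (h : HasValueGap g E N ρ) (hg : IsNonarchimedean g)
    {x : L} (hx : x ∈ E) (hx1 : g x ≤ 1) : g (x ^ (N.factorial + 1) - x) ≤ ρ := by
  refine h.le_of_lt_one _ (sub_mem (pow_mem hx _) hx) ?_
  have hfac : x ^ (N.factorial + 1) - x = x * (x ^ N.factorial - 1) := by ring
  rw [hfac, map_mul]
  have hle : ∀ m : ℕ, g (x ^ m - 1) ≤ 1 := by
    intro m
    rw [sub_eq_add_neg]
    refine (hg _ _).trans (max_le ?_ ?_)
    · rw [map_pow]; exact pow_le_one₀ (by positivity) hx1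
    · rw [AbsoluteValue.map_neg, map_one]
  rcases hx1.lt_or_eq with hlt | heq
  · exact (mul_le_of_le_one_right (by positivity) (hle _)).trans_lt hlt
  · rw [heq, one_mul]
    obtain ⟨i, j, hij, hlt⟩ : ∃ i j : Fin (N + 1), i < j ∧ g (x ^ (j - i : ℕ) - 1) < 1 := by
      have hsplit : ∀ i j : Fin (N + 1), i < j →
          g (x ^ (j : ℕ) - x ^ (i : ℕ)) = g (x ^ (j - i : ℕ) - 1) := by
        intro i j hij
        have hij' : (i : ℕ) < j := hij
        have : x ^ (j : ℕ) - x ^ (i : ℕ) = x ^ (i : ℕ) * (x ^ (j - i : ℕ) - 1) := by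
          rw [mul_sub, ← pow_add, mul_one, Nat.add_sub_cancel' hij'.le]
        rw [this, map_mul, map_pow, heq, one_pow, one_mul]
      obtain ⟨i, j, hij, hlt⟩ := h.exists_sub_lt_one (fun i => x ^ (i : ℕ))
        (fun i => pow_mem hx _) (fun i => by rw [map_pow, heq, one_pow])
      rcases lt_or_gt_of_ne hij with hij | hij
      · exact ⟨i, j, hij, by rw [← hsplit i j hij, g.map_sub]; exact hlt⟩
      · exact ⟨j, i, hij, by rw [← hsplit j i hij]; exact hlt⟩
    have hij' : (i : ℕ) < j := hij
    obtain ⟨c, hc⟩ : (j - i : ℕ) ∣ N.factorial :=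
      Nat.dvd_factorial (by omega) (by omega)
    rw [hc, pow_mul]
    set u := x ^ (j - i : ℕ)
    have hu : g u = 1 := by rw [map_pow, heq, one_pow]
    have : ∀ c : ℕ, g (u ^ c - 1) < 1 := by
      intro c
      induction c with
      | zero => simp
      | succ c ih =>
        have : u ^ (c + 1) - 1 = u * (u ^ c - 1) + (u - 1) := by ring
        rw [this]
        refine (hg _ _).trans_lt (max_lt ?_ hlt)
        rwa [map_mul, hu, one_mul]
    exact this c

theorem inv_le (h : HasValueGap g E N ρ) {x : L} (hx : x ∈ E) (hx1 : 1 < g x) :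
    (g x)⁻¹ ≤ ρ := by
  rw [← map_inv₀]
  refine h.le_of_lt_one _ (inv_mem hx) ?_
  rw [map_inv₀]
  exact inv_lt_one_of_one_lt₀ hx1

end HasValueGap

/-- The monic polynomial `X ^ (j % D) * (X ^ D - X) ^ (j / D)` of degree `j`. -/
noncomputable def frobPoly (L : Type*) [Field L] (D j : ℕ) : L[X] :=
  X ^ (j % D) * (X ^ D - X) ^ (j / D)

theorem monic_X_pow_sub_X {L : Type*} [Field L] {D : ℕ} (hD : 2 ≤ D) :
    (X ^ D - X : L[X]).Monic :=
  monic_X_pow_sub (by rw [degree_X]; exact_mod_cast hD)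

theorem frobPoly_monic {L : Type*} [Field L] {D : ℕ} (hD : 2 ≤ D) (j : ℕ) :
    (frobPoly L D j).Monic :=
  (monic_X_pow _).mul ((monic_X_pow_sub_X hD).pow _)

theorem natDegree_frobPoly {L : Type*} [Field L] {D : ℕ} (hD : 2 ≤ D) (j : ℕ) :
    (frobPoly L D j).natDegree = j := by
  have h1 : (X ^ D - X : L[X]).natDegree = D := FiniteField.X_pow_card_sub_X_natDegree_eq L hD
  rw [frobPoly, (monic_X_pow _).natDegree_mul ((monic_X_pow_sub_X hD).pow _), natDegree_X_pow,
    natDegree_pow, h1, mul_comm]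
  exact Nat.mod_add_div j D

/-- The two entries of the minimum are the two regimes. For integral z the factor z^D − z gains ρ
each of the j / D times. Otherwise |z|^j falls short of |z|^m by m − j factors |z|⁻¹ ≤ ρ. -/
theorem placeAbs_frobPoly_le {L : Type*} [Field L] {g : AbsoluteValue L ℝ}
    (hg : IsNonarchimedean g) {D : ℕ} (hD : 2 ≤ D) {ρ : ℝ} (hρ0 : 0 ≤ ρ) (hρ1 : ρ ≤ 1) {z : L}
    (h1 : g z ≤ 1 → g (z ^ D - z) ≤ ρ) (h2 : 1 < g z → (g z)⁻¹ ≤ ρ) {j m : ℕ} (hj : j ≤ m) :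
    g ((frobPoly L D j).eval z) ≤ max 1 (g z) ^ m * ρ ^ min (j / D) (m - j) := by
  have heval : (frobPoly L D j).eval z = z ^ (j % D) * (z ^ D - z) ^ (j / D) := by
    simp [frobPoly]
  rw [heval, map_mul, map_pow, map_pow]
  rcases le_or_gt (g z) 1 with hz | hz
  · rw [max_eq_left hz, one_pow, one_mul]
    calc _ ≤ 1 * ρ ^ (j / D) := by
          gcongr
          · exact pow_le_one₀ (by positivity) hz
          · exact h1 hz
      _ ≤ _ := by
          rw [one_mul]
          exact pow_le_pow_of_le_one hρ0 hρ1 (min_le_left _ _)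
  · have hlt : g (-z) < g (z ^ D) := by
      rw [AbsoluteValue.map_neg, map_pow]
      calc g z = g z ^ 1 := (pow_one _).symm
        _ < _ := pow_lt_pow_right₀ hz (by omega)
    have h3 : g (z ^ D - z) = g z ^ D := by
      rw [sub_eq_add_neg, hg.add_eq_max_of_ne hlt.ne', max_eq_left hlt.le, map_pow]
    have hz0 : g z ≠ 0 := by positivity
    rw [h3, max_eq_right hz.le, ← pow_mul, ← pow_add, Nat.mod_add_div]
    calc g z ^ j = g z ^ m * (g z)⁻¹ ^ (m - j) := by
          rw [inv_pow, eq_mul_inv_iff_mul_eq₀ (pow_ne_zero _ hz0), ← pow_add,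
            Nat.add_sub_cancel' hj]
      _ ≤ g z ^ m * ρ ^ (m - j) := by
          gcongr
          exact h2 hz
      _ ≤ _ := by
          gcongr _ * ?_
          exact pow_le_pow_of_le_one hρ0 hρ1 (min_le_right _ _)

theorem sum_mul_sub_range (n : ℕ) :
    ∑ j ∈ Finset.range n, (j : ℝ) * ((n : ℝ) - 1 - j) = n * (n - 1) * (n - 2) / 6 := by
  have h1 : ∀ n : ℕ, ∑ j ∈ Finset.range n, (j : ℝ) = n * (n - 1) / 2 := by
    intro n
    induction n with
    | zero => simp
    | succ n ih => rw [Finset.sum_range_succ, ih]; push_cast; ring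
  have h2 : ∀ n : ℕ, ∑ j ∈ Finset.range n, (j : ℝ) * j = n * (n - 1) * (2 * n - 1) / 6 := by
    intro n
    induction n with
    | zero => simp
    | succ n ih => rw [Finset.sum_range_succ, ih]; push_cast; ring
  simp only [mul_sub, Finset.sum_sub_distrib]
  rw [← Finset.sum_mul, ← Finset.sum_mul, h1, h2]
  ring

theorem le_sum_min_div {n D : ℕ} (hn : 1 ≤ n) (hD : 1 ≤ D) :
    ((n : ℝ) - 1) * (n - 2) / (6 * D) - n ≤
      (∑ j ∈ Finset.range n, min (j / D) (n - 1 - j) : ℕ) := by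
  have hn0 : (0 : ℝ) < n := by exact_mod_cast hn
  have hD0 : (1 : ℝ) ≤ D := by exact_mod_cast hD
  -- A smooth lower bound for both entries of the minimum, with a closed-form sum; the −1 absorbs
  -- the floor in j / D.
  have hterm : ∀ j ∈ Finset.range n, (j : ℝ) * ((n : ℝ) - 1 - j) / (D * n) - 1 ≤
      (min (j / D) (n - 1 - j) : ℕ) := by
    intro j hj
    rw [Finset.mem_range] at hj
    have hj' : (j : ℝ) + 1 ≤ n := by exact_mod_cast hj
    have hj0 : (0 : ℝ) ≤ j := by positivity
    have hcast : ((n - 1 - j : ℕ) : ℝ) = (n : ℝ) - 1 - j := by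
      rw [Nat.cast_sub (by omega), Nat.cast_sub hn, Nat.cast_one]
    rw [Nat.cast_min, le_min_iff, hcast]
    constructor
    · have h1 : (j : ℝ) < D * ((j / D : ℕ) + 1) := by
        exact_mod_cast Nat.lt_mul_div_succ j (by omega)
      rw [sub_le_iff_le_add, div_le_iff₀ (by positivity)]
      nlinarith
    · have h2 : (j : ℝ) * ((n : ℝ) - 1 - j) / (D * n) ≤ (n : ℝ) - 1 - j := by
        rw [div_le_iff₀ (by positivity)]
        have : (j : ℝ) ≤ D * n := by nlinarith
        nlinarith
      linarith
  have := Finset.sum_le_sum hterm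
  rw [Finset.sum_sub_distrib, ← Finset.sum_div, sum_mul_sub_range] at this
  push_cast at this ⊢
  refine le_trans (le_of_eq ?_) this
  rw [Finset.sum_const, Finset.card_range, nsmul_eq_mul, mul_one]
  field_simp

namespace ProductFormula

variable {K : Type*} [Field K] (M : ProductFormula K)

/-- The open unit ball is also closed, hence compact, so the norm attains a maximum below 1 on it.
Covering the closed unit ball by finitely many open balls of radius 1 bounds the residue field. -/
theorem exists_gap_compl {v : M.Place} (hv : IsNonarchimedean (M.absVal v))
    (hv' : (M.absVal v).IsNontrivial) (hlc : LocallyCompactSpace (M.Compl v)) :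
    ∃ ρ : ℝ, 0 < ρ ∧ ρ < 1 ∧ (∀ x : M.Compl v, ‖x‖ < 1 → ‖x‖ ≤ ρ) ∧
      ∃ t : Finset (M.Compl v), ∀ x : M.Compl v, ‖x‖ ≤ 1 → ∃ y ∈ t, ‖x - y‖ < 1 := by
  let := M.nontriviallyNormedFieldCompl hv'
  have := M.isUltrametricDist_compl hv
  have hproper : ProperSpace (M.Compl v) := ProperSpace.of_locallyCompactSpace (M.Compl v)
  have hcb : IsCompact (Metric.closedBall (0 : M.Compl v) 1) := isCompact_closedBall _ _
  have hb : IsCompact (Metric.ball (0 : M.Compl v) 1) :=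
    hcb.of_isClosed_subset (IsUltrametricDist.isClosed_ball _ _) Metric.ball_subset_closedBall
  obtain ⟨x₀, hx₀, hmax⟩ := hb.exists_isMaxOn ⟨0, Metric.mem_ball_self one_pos⟩
    continuous_norm.continuousOn
  rw [mem_ball_zero_iff] at hx₀
  obtain ⟨t, -, htfin, ht⟩ := hcb.finite_cover_balls one_pos
  -- The 1/2 only ensures that ρ is positive.
  refine ⟨max ‖x₀‖ (1 / 2), by positivity, max_lt hx₀ (by norm_num), fun x hx => ?_,
    htfin.toFinset, fun x hx => ?_⟩
  · exact le_max_of_le_left (hmax (mem_ball_zero_iff.mpr hx))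
  · have := ht (mem_closedBall_zero_iff.mpr hx)
    simp only [Set.mem_iUnion, Metric.mem_ball, dist_eq_norm] at this
    obtain ⟨y, hy, hlt⟩ := this
    exact ⟨y, htfin.mem_toFinset.mpr hy, hlt⟩

theorem valuation_eq_extAbs {v : M.Place} (hv : IsNonarchimedean (M.absVal v))
    (hv' : (M.absVal v).IsNontrivial) (F : IntermediateField (M.Compl v) (M.ComplBar v))
    (w : Valuation F ℝ≥0) (hw : ∀ x : M.Compl v, (w (algebraMap (M.Compl v) F x) : ℝ) = ‖x‖)
    (x : F) : (w x : ℝ) = M.extAbs v x := by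
  let := M.nontriviallyNormedFieldCompl hv'
  have := M.isUltrametricDist_compl hv
  let g : AbsoluteValue F ℝ :=
    ⟨⟨fun y => (w y : ℝ), fun y z => by simp⟩, fun y => NNReal.coe_nonneg _,
      fun y => by simp, fun y z => by
        have h1 := w.map_add y z
        have h2 : w (y + z) ≤ w y + w z := h1.trans (max_le (by simp) (by simp))
        exact_mod_cast h2⟩
  have h := spectralNorm_unique_field_norm_ext (f := g) hw x
  rw [extAbs_eq_spectralNorm M hv hv']
  refine Eq.trans h ?_
  exact spectralNorm.eq_of_tower (K := M.Compl v) (E := F) (L := M.ComplBar v) x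

/-- The absolute value `x ↦ |τ x|_v`. -/
noncomputable def conjAbs (v : M.Place) (τ : AlgebraicClosure K ≃ₐ[K] AlgebraicClosure K) :
    AbsoluteValue (AlgebraicClosure K) ℝ :=
  (M.placeAbs v).comp (f := (τ : AlgebraicClosure K →+* AlgebraicClosure K)) τ.injective

theorem conjAbs_apply (v : M.Place) (τ : AlgebraicClosure K ≃ₐ[K] AlgebraicClosure K)
    (x : AlgebraicClosure K) : M.conjAbs v τ x = M.placeAbs v (τ x) := rfl

theorem conjAbs_isNonarchimedean {v : M.Place} (hv : IsNonarchimedean (M.absVal v))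
    (τ : AlgebraicClosure K ≃ₐ[K] AlgebraicClosure K) : IsNonarchimedean (M.conjAbs v τ) := by
  intro x y
  simp only [conjAbs_apply, map_add]
  exact M.placeAbs_isNonarchimedean hv _ _

/-- Ramification at most e turns the gap ρ₀ of K_v into ρ₀^(1/e), and residue degree at most f
leaves at most q^f residue classes, q bounding the residue field of K_v. The hypothesis covers all
embeddings, so it applies after any automorphism τ. -/
theorem exists_hasValueGap {v : M.Place} (hv : IsNonarchimedean (M.absVal v))
    (hv' : (M.absVal v).IsNontrivial) (hlc : LocallyCompactSpace (M.Compl v)) {e : ℕ} (f : ℕ)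
    (he : 0 < e) :
    ∃ (N : ℕ) (ρ : ℝ), 0 < ρ ∧ ρ < 1 ∧ ∀ α : AlgebraicClosure K, M.IsTotallyAdicElement v e f α →
      ∀ τ : AlgebraicClosure K ≃ₐ[K] AlgebraicClosure K,
        HasValueGap (M.conjAbs v τ) (IntermediateField.adjoin K {α}) N ρ := by
  classical
  obtain ⟨ρ₀, h0, h1, hgap, t, ht⟩ := M.exists_gap_compl hv hv' hlc
  set ρ : ℝ := ρ₀ ^ (1 / e : ℝ) with hρ
  have hρe : ρ ^ e = ρ₀ := by
    rw [hρ, one_div]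
    exact Real.rpow_inv_natCast_pow h0.le he.ne'
  refine ⟨t.card ^ f, ρ, Real.rpow_pos_of_pos h0 _, Real.rpow_lt_one h0.le h1 (by positivity),
    fun α hα τ => ?_⟩
  obtain ⟨F, hF, hσF, w, hw, hwe, hwf⟩ := hα
    (((M.embed v).comp (τ : AlgebraicClosure K →ₐ[K] AlgebraicClosure K)).comp
      (IntermediateField.adjoin K {α}).val)
  have habs : ∀ x (hx : x ∈ IntermediateField.adjoin K {α}),
      M.conjAbs v τ x = w ⟨_, hσF ⟨x, hx⟩⟩ := by
    intro x hx
    rw [M.valuation_eq_extAbs hv hv' F w hw]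
    exact M.placeAbs_apply v (τ x)
  have hcomap : ∀ x : M.Compl v, ((w.comap (algebraMap (M.Compl v) F)) x : ℝ) = ‖x‖ := hw
  have hchoice : ∀ x : M.Compl v, ∃ y : t, ‖x‖ ≤ 1 → ‖x - y‖ < 1 := by
    intro x
    by_cases hx : ‖x‖ ≤ 1
    · obtain ⟨y, hy, h⟩ := ht x hx
      exact ⟨⟨y, hy⟩, fun _ => h⟩
    · obtain ⟨y, hy, -⟩ := ht 0 (by simp)
      exact ⟨⟨y, hy⟩, fun h => absurd h hx⟩
  choose c hc using hchoice
  choose r hr using IsLocalRing.residue_surjective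
    (R := (w.comap (algebraMap (M.Compl v) F)).valuationSubring)
  -- Lifts of distinct residue classes lie in different unit balls, so the residue field has at most
  -- as many elements as t.
  have hinj : Function.Injective (fun a => c (r a : M.Compl v)) := by
    intro a b hab
    have hle : ∀ a, ‖(r a : M.Compl v)‖ ≤ 1 := fun a => by
      rw [← hcomap]; exact_mod_cast (r a).2
    have ha := hc _ (hle a)
    have hb := hc _ (hle b)
    simp only at hab
    rw [← hab] at hb
    have hlt : ‖(r a : M.Compl v) - r b‖ < 1 := by
      have hsub : (r a : M.Compl v) - r b = ((r a : M.Compl v) - c (r a : M.Compl v)) +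
        -((r b : M.Compl v) - c (r a : M.Compl v)) := by ring
      rw [hsub]
      refine (M.isNonarchimedean_norm_compl hv _ _).trans_lt (max_lt ha ?_)
      rwa [norm_neg]
    rw [← hr a, ← hr b, ← sub_eq_zero, ← map_sub, IsLocalRing.residue_eq_zero_iff,
      Valuation.mem_maximalIdeal_iff]
    rw [← hcomap] at hlt
    exact_mod_cast hlt
  have hfin := Finite.of_injective _ hinj
  have hcard := Nat.card_le_card_of_injective _ hinj
  rw [Nat.card_eq_fintype_card (α := t), Fintype.card_coe] at hcard
  refine ⟨fun x hx hlt => ?_, fun y hy hy1 => ?_⟩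
  · rw [habs x hx] at hlt ⊢
    have hpow := pow_le_of_ramificationIndex_le (M.Compl v) w hwe (ρ := ⟨ρ₀, h0.le⟩)
      (fun y hy => by
        have hy' : ‖y‖ < 1 := by rw [← hw]; exact_mod_cast hy
        have := hgap y hy'
        rw [← hw] at this
        exact this) (by exact_mod_cast hlt)
    have hpow' : (w ⟨_, hσF ⟨x, hx⟩⟩ : ℝ) ^ e ≤ ρ₀ := by exact_mod_cast hpow
    rw [← hρe] at hpow'
    exact (pow_le_pow_iff_left₀ (by positivity) (Real.rpow_nonneg h0.le _) he.ne').mp hpow'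
  · obtain ⟨i, j, hij, hlt⟩ := exists_sub_lt_one_of_residueDegree_le (M.Compl v) w hwf hfin hcard
      (ι := Fin (t.card ^ f + 1)) (by simp) (fun i => ⟨_, hσF ⟨y i, hy i⟩⟩) (fun i => by
        have := hy1 i
        rw [habs _ (hy i)] at this
        exact_mod_cast this)
    refine ⟨i, j, hij, ?_⟩
    rw [habs _ (sub_mem (hy i) (hy j))]
    have heq : (⟨_, hσF ⟨y i - y j, sub_mem (hy i) (hy j)⟩⟩ : F) =
        ⟨_, hσF ⟨y i, hy i⟩⟩ - ⟨_, hσF ⟨y j, hy j⟩⟩ := by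
      apply Subtype.ext
      simp
    rw [heq]
    exact_mod_cast hlt

/-- V is computed in the monic basis `frobPoly`. Each column j contributes its own power of ρ and
each row only max(1, |z_i|)^(n−1), so all permutations share one bound. -/
theorem log_conjVandermonde_add_gain_le {v : M.Place} (hv : IsNonarchimedean (M.absVal v))
    {N : ℕ} {ρ : ℝ} (hρ0 : 0 < ρ) (hρ1 : ρ < 1) {α : AlgebraicClosure K}
    (h : ∀ τ : AlgebraicClosure K ≃ₐ[K] AlgebraicClosure K,
      HasValueGap (M.conjAbs v τ) (IntermediateField.adjoin K {α}) N ρ) :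
    Real.log (M.placeAbs v (conjVandermonde α)) +
      -Real.log ρ * ((((conjugates α).card : ℝ) - 1) * ((conjugates α).card - 2) /
        (6 * (N.factorial + 1 : ℕ)) - (conjugates α).card) ≤
      ∑ i, ((conjugates α).card - 1 : ℕ) * Real.posLog (M.placeAbs v (conjEnum α i)) := by
  have hna := M.placeAbs_isNonarchimedean hv
  set n := (conjugates α).card with hn
  set D := N.factorial + 1 with hD
  have hD2 : 2 ≤ D := by have := N.factorial_pos; omega
  have hn1 : 1 ≤ n := card_conjugates_pos α
  set z := conjEnum α with hz
  have hgap : ∀ i, (M.placeAbs v (z i) ≤ 1 → M.placeAbs v (z i ^ D - z i) ≤ ρ) ∧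
      (1 < M.placeAbs v (z i) → (M.placeAbs v (z i))⁻¹ ≤ ρ) := by
    intro i
    obtain ⟨τ, hτ⟩ := mem_conjugates_iff.mp (conjEnum_mem α i)
    have hα : α ∈ IntermediateField.adjoin K {α} := IntermediateField.mem_adjoin_simple_self K α
    constructor
    · intro hle
      have := (h τ).pow_sub_self_le (M.conjAbs_isNonarchimedean hv τ) hα (by rw [conjAbs_apply, hτ]; exact hle)
      rwa [conjAbs_apply, map_sub, map_pow, hτ] at this
    · intro hlt
      have := (h τ).inv_le hα (by rw [conjAbs_apply, hτ]; exact hlt)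
      rwa [conjAbs_apply, hτ] at this
  set s : ℕ := ∑ j ∈ Finset.range n, min (j / D) (n - 1 - j) with hs
  have hV : conjVandermonde α =
      (Matrix.of fun i j : Fin n => (frobPoly (AlgebraicClosure K) D j).eval (z i)).det :=
    Matrix.det_eval_matrixOfPolynomials_eq_det_vandermonde z
      (fun j : Fin n => frobPoly (AlgebraicClosure K) D j) (fun j => natDegree_frobPoly hD2 j)
      (fun j => frobPoly_monic hD2 j)
  have hle : M.placeAbs v (conjVandermonde α) ≤
      (∏ i, max 1 (M.placeAbs v (z i)) ^ (n - 1)) * ρ ^ s := by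
    rw [hV]
    refine hna.det_le _ fun σ => ?_
    rw [← Equiv.prod_comp σ fun i => max 1 (M.placeAbs v (z i)) ^ (n - 1), hs, ← Fin.sum_univ_eq_sum_range
      (fun j => min (j / D) (n - 1 - j)), ← Finset.prod_pow_eq_pow_sum, ← Finset.prod_mul_distrib]
    refine Finset.prod_le_prod (fun i _ => by positivity) fun i _ => ?_
    exact placeAbs_frobPoly_le hna hD2 hρ0.le hρ1.le (hgap _).1 (hgap _).2 (by omega)
  have hpos : ∀ i, 0 < max 1 (M.placeAbs v (z i)) := fun i => lt_max_of_lt_left one_pos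
  have hlog := Real.log_le_log ((M.placeAbs v).pos (conjVandermonde_ne_zero α)) hle
  rw [Real.log_mul (Finset.prod_ne_zero_iff.mpr fun i _ => pow_ne_zero _ (hpos i).ne')
    (pow_ne_zero _ hρ0.ne'), Real.log_prod fun i _ => pow_ne_zero _ (hpos i).ne',
    Real.log_pow] at hlog
  have hsum : ∑ i, Real.log (max 1 (M.placeAbs v (z i)) ^ (n - 1)) =
      ∑ i, ((n - 1 : ℕ) : ℝ) * Real.posLog (M.placeAbs v (z i)) :=
    Finset.sum_congr rfl fun i _ => by
      rw [Real.log_pow, Real.posLog_eq_log_max_one (by positivity)]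
  rw [hsum] at hlog
  have hlogρ : 0 ≤ -Real.log ρ := by
    have := Real.log_neg hρ0 hρ1
    linarith
  have := mul_le_mul_of_nonneg_left (le_sum_min_div hn1 (by omega : 1 ≤ D)) hlogρ
  linarith

end ProductFormula

/-! ### Pigeonhole in value gaps and the bound for the full degree. -/

namespace HasValueGap

variable {K L : Type*} [Field K] [Field L] [Algebra K L] {g : AbsoluteValue L ℝ}
  {E : IntermediateField K L} {N : ℕ} {ρ : ℝ}

theorem card_pos (h : HasValueGap g E N ρ) : 0 < N := by
  obtain ⟨i, j, hij, -⟩ := h.exists_sub_lt_one (fun _ => 0) (fun _ => zero_mem E) (fun _ => by simp)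
  have : (i : ℕ) ≠ j := fun h => hij (Fin.ext h)
  omega

/-- After division by a largest difference b all differences are integral, so the points fall into
at most N residue classes. Within a class differences are below |b|, hence at most ρ|b| by the gap,
and some class keeps more than k points. -/
theorem exists_subset_step (h : HasValueGap g E N ρ) (hg : IsNonarchimedean g) (hρ : 0 ≤ ρ)
    {ι : Type*} {y : ι → L} (hy : ∀ i, y i ∈ E) {s : Finset ι} {R : ℝ}
    (hR : ∀ i ∈ s, ∀ j ∈ s, g (y i - y j) ≤ R) {k : ℕ} (hk : N * k < s.card) :
    ∃ s' ⊆ s, k < s'.card ∧ ∀ i ∈ s', ∀ j ∈ s', g (y i - y j) ≤ ρ * R := by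
  classical
  have hne : s.Nonempty := Finset.card_pos.mp (by omega)
  obtain ⟨⟨i₀, j₀⟩, hmem, hmax⟩ := Finset.exists_max_image (s ×ˢ s)
    (fun p => g (y p.1 - y p.2)) (hne.product hne)
  rw [Finset.mem_product] at hmem
  set b := y i₀ - y j₀ with hb
  have hbR : g b ≤ R := hR _ hmem.1 _ hmem.2
  have hle : ∀ i ∈ s, ∀ j ∈ s, g (y i - y j) ≤ g b := fun i hi j hj =>
    hmax (i, j) (Finset.mk_mem_product hi hj)
  have hR0 : 0 ≤ R := (g.nonneg _).trans hbR
  by_cases hb0 : b = 0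
  · refine ⟨s, subset_rfl, ?_, fun i hi j hj => (hle i hi j hj).trans ?_⟩
    · exact (Nat.le_mul_of_pos_left k h.card_pos).trans_lt hk
    · rw [hb0, map_zero]; positivity
  have hgb : 0 < g b := g.pos hb0
  let S : Setoid ι :=
    { r := fun i j => g (y i - y j) < g b
      iseqv :=
        { refl := fun i => by simpa using hgb
          symm := fun {i j} hij => by rwa [g.map_sub]
          trans := fun {i j l} hij hjl => by
            have : y i - y l = (y i - y j) + (y j - y l) := by ring
            rw [this]
            exact (hg _ _).trans_lt (max_lt hij hjl) } }
  have hcard : (s.image (Quotient.mk S)).card ≤ N := by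
    by_contra! hlt
    obtain ⟨emb⟩ := Function.Embedding.nonempty_of_card_le (α := Fin (N + 1))
      (β := s.image (Quotient.mk S)) (by simpa using hlt)
    have hrep : ∀ q : s.image (Quotient.mk S), ∃ i ∈ s, Quotient.mk S i = q := fun q =>
      Finset.mem_image.mp q.2
    choose r hrs hr using hrep
    obtain ⟨i, j, hij, hlt⟩ := h.exists_sub_lt_one
      (fun i => (y (r (emb i)) - y i₀) / b)
      (fun i => div_mem (sub_mem (hy _) (hy _)) (sub_mem (hy _) (hy _)))
      (fun i => by
        rw [map_div₀]
        exact div_le_one_of_le₀ (hle _ (hrs _) _ hmem.1) hgb.le)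
    have hsub : (y (r (emb i)) - y i₀) / b - (y (r (emb j)) - y i₀) / b =
        (y (r (emb i)) - y (r (emb j))) / b := by ring
    simp only [hsub] at hlt
    rw [map_div₀, div_lt_one hgb] at hlt
    apply hij
    apply emb.injective
    apply Subtype.ext
    rw [← hr, ← hr]
    exact Quotient.sound hlt
  obtain ⟨q, -, hq⟩ := Finset.exists_lt_card_fiber_of_mul_lt_card_of_maps_to
    (s := s) (t := s.image (Quotient.mk S)) (f := Quotient.mk S) (n := k)
    (fun i hi => Finset.mem_image_of_mem _ hi)
    ((Nat.mul_le_mul_right k hcard).trans_lt hk)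
  refine ⟨s.filter (fun i => Quotient.mk S i = q), Finset.filter_subset _ _, hq,
    fun i hi j hj => ?_⟩
  rw [Finset.mem_filter] at hi hj
  have hij : g (y i - y j) < g b := Quotient.exact (hi.2.trans hj.2.symm)
  have hdiv := h.le_of_lt_one ((y i - y j) / b)
    (div_mem (sub_mem (hy _) (hy _)) (sub_mem (hy _) (hy _)))
    (by rw [map_div₀, div_lt_one hgb]; exact hij)
  rw [map_div₀, div_le_iff₀ hgb] at hdiv
  exact hdiv.trans (by gcongr)

theorem exists_subset (h : HasValueGap g E N ρ) (hg : IsNonarchimedean g) (hρ : 0 ≤ ρ)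
    {ι : Type*} {y : ι → L} (hy : ∀ i, y i ∈ E) (T : ℕ) {s : Finset ι} {R : ℝ}
    (hR : ∀ i ∈ s, ∀ j ∈ s, g (y i - y j) ≤ R) {k : ℕ} (hk : N ^ T * k < s.card) :
    ∃ s' ⊆ s, k < s'.card ∧ ∀ i ∈ s', ∀ j ∈ s', g (y i - y j) ≤ ρ ^ T * R := by
  induction T generalizing k with
  | zero => exact ⟨s, subset_rfl, by simpa using hk, by simpa using hR⟩
  | succ T ih =>
    obtain ⟨s₁, hs₁, hk₁, hR₁⟩ := ih (k := N * k) (by rwa [← mul_assoc, ← pow_succ])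
    obtain ⟨s₂, hs₂, hk₂, hR₂⟩ := h.exists_subset_step hg hρ hy hR₁ hk₁
    refine ⟨s₂, hs₂.trans hs₁, hk₂, fun i hi j hj => ?_⟩
    rw [pow_succ', mul_assoc]
    exact hR₂ i hi j hj

end HasValueGap

theorem exists_subset_of_forall_hasValueGap {K L κ : Type*} [Field K] [Field L] [Algebra K L]
    {g : κ → AbsoluteValue L ℝ} {E : IntermediateField K L} {N : ℕ} {ρ : ℝ} (A : Finset κ)
    (h : ∀ a ∈ A, HasValueGap (g a) E N ρ) (hg : ∀ a ∈ A, IsNonarchimedean (g a)) (hρ : 0 ≤ ρ)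
    {ι : Type*} {y : ι → L} (hy : ∀ i, y i ∈ E) (T : ℕ) {s : Finset ι} {R : κ → ℝ}
    (hR : ∀ a ∈ A, ∀ i ∈ s, ∀ j ∈ s, g a (y i - y j) ≤ R a) {k : ℕ}
    (hk : N ^ (T * A.card) * k < s.card) :
    ∃ s' ⊆ s, k < s'.card ∧
      ∀ a ∈ A, ∀ i ∈ s', ∀ j ∈ s', g a (y i - y j) ≤ ρ ^ T * R a := by
  classical
  induction A using Finset.induction_on generalizing k with
  | empty => exact ⟨s, subset_rfl, by simpa using hk, by simp⟩
  | insert a A ha ih =>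
    obtain ⟨s₁, hs₁, hk₁, hR₁⟩ := ih (fun b hb => h b (Finset.mem_insert_of_mem hb))
      (fun b hb => hg b (Finset.mem_insert_of_mem hb))
      (fun b hb => hR b (Finset.mem_insert_of_mem hb)) (k := N ^ T * k) (by
        rwa [Finset.card_insert_of_notMem ha, mul_add, mul_one, pow_add, mul_assoc] at hk)
    have haA := Finset.mem_insert_self a A
    obtain ⟨s₂, hs₂, hk₂, hR₂⟩ := (h a haA).exists_subset (hg a haA) hρ hy T
      (fun i hi j hj => hR a haA i (hs₁ hi) j (hs₁ hj)) hk₁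
    refine ⟨s₂, hs₂.trans hs₁, hk₂, fun b hb i hi j hj => ?_⟩
    rcases Finset.mem_insert.mp hb with rfl | hb
    · exact hR₂ i hi j hj
    · exact hR₁ b hb i (hs₂ hi) j (hs₂ hj)

namespace ProductFormula

variable {K : Type*} [Field K] (M : ProductFormula K)

theorem infinite_of_isNontrivial {v : M.Place} (hv : (M.absVal v).IsNontrivial) : Infinite K := by
  by_contra h
  rw [not_infinite_iff_finite] at h
  have := Fintype.ofFinite K
  obtain ⟨x, hx, hne⟩ := hv
  have h1 := congrArg (M.absVal v) (FiniteField.pow_card_sub_one_eq_one x hx)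
  rw [map_pow, map_one] at h1
  have hc := Fintype.one_lt_card (α := K)
  exact hne ((pow_eq_one_iff_of_nonneg (by positivity) (by omega)).mp h1)

theorem algEquiv_prod_aeval_conjugates (α : AlgebraicClosure K) (p : K[X])
    (σ : AlgebraicClosure K ≃ₐ[K] AlgebraicClosure K) :
    σ (∏ z ∈ conjugates α, aeval z p) = ∏ z ∈ conjugates α, aeval z p := by
  rw [map_prod]
  refine Finset.prod_bij' (fun z _ => σ z) (fun z _ => σ.symm z) ?_ ?_
    (fun z _ => σ.symm_apply_apply z) (fun z _ => σ.apply_symm_apply z) ?_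
  · intro z hz
    obtain ⟨τ, rfl⟩ := mem_conjugates_iff.mp hz
    exact mem_conjugates_iff.mpr ⟨τ.trans σ, rfl⟩
  · intro z hz
    obtain ⟨τ, rfl⟩ := mem_conjugates_iff.mp hz
    exact mem_conjugates_iff.mpr ⟨τ.trans σ.symm, rfl⟩
  · intro z _
    exact (aeval_algHom_apply (σ : AlgebraicClosure K →ₐ[K] AlgebraicClosure K) z p).symm

theorem wsum_sum_log_aeval_conjugates (α : AlgebraicClosure K) {p : K[X]}
    (hp : ∀ z ∈ conjugates α, aeval z p ≠ 0) :
    M.wsum (fun w => ∑ z ∈ conjugates α, Real.log (M.placeAbs w (aeval z p))) = 0 := by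
  rw [← M.wsum_log_placeAbs_of_fixed (Finset.prod_ne_zero_iff.mpr hp)
    (algEquiv_prod_aeval_conjugates α p)]
  congr 1
  ext w
  rw [map_prod, Real.log_prod fun z hz => (M.placeAbs w).ne_zero (hp z hz)]

theorem placeAbs_aeval_le {w : M.Place} (hw : IsNonarchimedean (M.absVal w)) {p : K[X]} {m : ℕ}
    (hp : p.natDegree ≤ m) {A : ℝ} (hA : ∀ i, M.absVal w (p.coeff i) ≤ A)
    (z : AlgebraicClosure K) :
    M.placeAbs w (aeval z p) ≤ A * max 1 (M.placeAbs w z) ^ m := by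
  have hA0 : 0 ≤ A := ((M.absVal w).nonneg _).trans (hA 0)
  rw [aeval_eq_sum_range]
  obtain ⟨i, hi, hle⟩ := (M.placeAbs_isNonarchimedean hw).finset_image_add_of_nonempty
    (fun i => p.coeff i • z ^ i) (t := Finset.range (p.natDegree + 1)) (by simp)
  refine hle.trans ?_
  rw [Algebra.smul_def, map_mul, placeAbs_algebraMap, map_pow]
  rw [Finset.mem_range] at hi
  gcongr
  · exact hA i
  · calc M.placeAbs w z ^ i ≤ max 1 (M.placeAbs w z) ^ i := by gcongr; exact le_max_right _ _
      _ ≤ _ := pow_le_pow_right₀ (le_max_left _ _) (by omega)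

/-- If all places are ultrametric, algebraic numbers with a bounded number of conjugates, bounded
height and uniform value gaps at `v` have bounded degree. -/
theorem exists_natDegree_le {v : M.Place} (hv' : (M.absVal v).IsNontrivial)
    (hall : ∀ w, IsNonarchimedean (M.absVal w)) {N : ℕ} {ρ : ℝ} (hρ0 : 0 < ρ) (hρ1 : ρ < 1)
    (n₀ : ℕ) {B : ℝ} (hB : 0 ≤ B) :
    ∃ d₀ : ℕ, ∀ α : AlgebraicClosure K,
      (∀ τ : AlgebraicClosure K ≃ₐ[K] AlgebraicClosure K,
        HasValueGap (M.conjAbs v τ) (IntermediateField.adjoin K {α}) N ρ) →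
      (conjugates α).card ≤ n₀ → M.height α ≤ B → (minpoly K α).natDegree ≤ d₀ := by
  classical
  have := M.infinite_of_isNontrivial hv'
  have hlogρ : 0 < -Real.log ρ := by
    have := Real.log_neg hρ0 hρ1
    linarith
  -- With s gap steps per unit of degree, the gain at v exceeds the height cost B by 1 per unit of
  -- degree.
  obtain ⟨s, hs⟩ := exists_nat_ge ((B + 1) / (M.weight v * -Real.log ρ))
  rw [div_le_iff₀ (mul_pos (M.weight_pos v) hlogρ)] at hs
  -- X₀ is fixed before α: polynomials with m + 1 coefficients in X₀ outnumber the N^(s·n₀·(m+1))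
  -- boxes of the pigeonhole, whatever m is.
  obtain ⟨X₀, hX₀⟩ := Infinite.exists_subset_card_eq K (N ^ (s * n₀) + 1)
  let lx : M.Place → ℝ := fun w => ∑ p ∈ X₀ ×ˢ X₀, Real.posLog (M.absVal w (p.1 - p.2))
  have hlxfin : lx.support.Finite := by
    refine M.support_sum_finite fun p _ => ?_
    by_cases h0 : p.1 - p.2 = 0
    · simp [h0]
    · exact (M.finite_ne_one _ h0).subset fun w hw h => hw (by simp [h])
  have hlx : ∀ w, ∀ a ∈ X₀, ∀ b ∈ X₀, M.absVal w (a - b) ≤ Real.exp (lx w) := by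
    intro w a ha b hb
    have h1 : Real.posLog (M.absVal w (a - b)) ≤ lx w :=
      Finset.single_le_sum (f := fun p : K × K => Real.posLog (M.absVal w (p.1 - p.2)))
        (fun _ _ => Real.posLog_nonneg) (Finset.mk_mem_product ha hb)
    refine le_trans ?_ (Real.exp_le_exp.mpr h1)
    rw [Real.posLog_eq_log_max_one (by positivity), Real.exp_log (lt_max_of_lt_left one_pos)]
    exact le_max_right _ _
  obtain ⟨d₀, hd₀⟩ := exists_nat_ge (M.wsum lx)
  refine ⟨d₀, fun α hgap hn hα => ?_⟩
  have hint : IsIntegral K α := Algebra.IsIntegral.isIntegral α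
  obtain ⟨m, hm⟩ : ∃ m, (minpoly K α).natDegree = m + 1 :=
    Nat.exists_eq_succ_of_ne_zero (minpoly.natDegree_pos hint).ne'
  have hτ : ∀ z ∈ conjugates α, ∃ τ : AlgebraicClosure K ≃ₐ[K] AlgebraicClosure K, τ α = z :=
    fun z hz => mem_conjugates_iff.mp hz
  choose! τ hτ using hτ
  let P : (Fin (m + 1) → X₀) → K[X] := fun c => ∑ i : Fin (m + 1), C (c i : K) * X ^ (i : ℕ)
  have hPcoeff : ∀ c (i : Fin (m + 1)), (P c).coeff i = c i := by
    intro c i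
    simp only [P, finsetSum_coeff, coeff_C_mul, coeff_X_pow]
    rw [Finset.sum_eq_single i (fun j _ hj => by
      rw [if_neg (fun h => hj (Fin.ext h.symm)), mul_zero]) (fun h => absurd (Finset.mem_univ _) h)]
    simp
  have hPdeg : ∀ c, (P c).natDegree ≤ m := fun c =>
    natDegree_sum_le_of_forall_le _ _ fun i _ => (natDegree_C_mul_X_pow_le _ _).trans (by omega)
  have hPsub : ∀ c c', (P c - P c').natDegree ≤ m := fun c c' =>
    (natDegree_sub_le _ _).trans (max_le (hPdeg c) (hPdeg c'))
  have hPbound : ∀ w c c' i, M.absVal w ((P c - P c').coeff i) ≤ Real.exp (lx w) := by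
    intro w c c' i
    by_cases hi : i < m + 1
    · rw [coeff_sub, hPcoeff c ⟨i, hi⟩, hPcoeff c' ⟨i, hi⟩]
      exact hlx w _ (c _).2 _ (c' _).2
    · rw [coeff_eq_zero_of_natDegree_lt ((hPsub c c').trans_lt (by omega)), map_zero]
      positivity
  have hval : ∀ w c c' z, M.placeAbs w (aeval z (P c - P c')) ≤
      Real.exp (lx w) * max 1 (M.placeAbs w z) ^ m := fun w c c' z =>
    M.placeAbs_aeval_le (hall w) (hPsub c c') (hPbound w c c') z
  have happ : ∀ z ∈ conjugates α, ∀ c c', M.conjAbs v (τ z) (aeval α (P c) - aeval α (P c')) =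
      M.placeAbs v (aeval z (P c - P c')) := by
    intro z hz c c'
    rw [conjAbs_apply, ← map_sub]
    congr 1
    conv_rhs => rw [← hτ z hz]
    exact (aeval_algHom_apply ((τ z : AlgebraicClosure K ≃ₐ[K] AlgebraicClosure K) :
      AlgebraicClosure K →ₐ[K] AlgebraicClosure K) α _).symm
  set T := s * (m + 1) with hT
  have hcard : N ^ (T * (conjugates α).card) * 1 <
      (Finset.univ : Finset (Fin (m + 1) → X₀)).card := by
    have hN : 0 < N := (hgap AlgEquiv.refl).card_pos
    rw [Finset.card_univ, Fintype.card_fun, Fintype.card_coe, Fintype.card_fin, hX₀, mul_one]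
    calc N ^ (T * (conjugates α).card) ≤ N ^ (s * n₀ * (m + 1)) := by
          refine Nat.pow_le_pow_right hN ?_
          rw [hT, mul_right_comm]
          gcongr
      _ = (N ^ (s * n₀)) ^ (m + 1) := by rw [← pow_mul]
      _ < _ := Nat.pow_lt_pow_left (Nat.lt_succ_self _) (by omega)
  obtain ⟨s', -, hs', hclose⟩ := exists_subset_of_forall_hasValueGap (κ := AlgebraicClosure K)
    (g := fun z => M.conjAbs v (τ z)) (conjugates α) (fun z _ => hgap (τ z))
    (fun z _ => M.conjAbs_isNonarchimedean (hall v) (τ z)) hρ0.le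
    (y := fun c => aeval α (P c))
    (fun c => (IntermediateField.algebra_adjoin_le_adjoin K _)
      (aeval_mem_adjoin_singleton K α)) T
    (R := fun z => Real.exp (lx v) * max 1 (M.placeAbs v z) ^ m)
    (fun z hz c _ c' _ => by rw [happ z hz]; exact hval v c c' z) hcard
  obtain ⟨c, hc, c', hc', hne⟩ := Finset.one_lt_card.mp hs'
  set p := P c - P c' with hp
  have hp0 : p ≠ 0 := by
    intro h0
    apply hne
    ext i
    rw [← hPcoeff c i, ← hPcoeff c' i, ← sub_eq_zero, ← coeff_sub, ← hp, h0, coeff_zero]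
  -- Nonvanishing uses deg p ≤ m < m + 1 = deg α, the full and not the separable degree; this is how
  -- inseparability gets bounded.
  have hpα : ∀ z ∈ conjugates α, aeval z p ≠ 0 := by
    intro z hz h0
    rw [← hτ z hz] at h0
    have h1 : (τ z) (aeval α p) = 0 := by
      rw [← h0]
      exact (aeval_algHom_apply ((τ z : AlgebraicClosure K ≃ₐ[K] AlgebraicClosure K) :
        AlgebraicClosure K →ₐ[K] AlgebraicClosure K) α p).symm
    have h2 : aeval α p = 0 := by simpa using h1
    have h3 := natDegree_le_of_dvd (minpoly.dvd K α h2) hp0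
    have h4 : p.natDegree ≤ m := hPsub c c'
    omega
  have hlocal : ∀ w, ∑ z ∈ conjugates α, Real.log (M.placeAbs w (aeval z p)) +
      (if w = v then (conjugates α).card * (T * -Real.log ρ) else 0) ≤
      (conjugates α).card * lx w +
        ∑ z ∈ conjugates α, (m : ℝ) * Real.posLog (M.placeAbs w z) := by
    intro w
    have hM : ∀ z, 0 < max 1 (M.placeAbs w z) := fun z => lt_max_of_lt_left one_pos
    by_cases hw : w = v
    · subst hw
      rw [if_pos rfl, ← nsmul_eq_mul (conjugates α).card, ← Finset.sum_const, ← Finset.sum_add_distrib,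
        ← nsmul_eq_mul (conjugates α).card, ← Finset.sum_const, ← Finset.sum_add_distrib]
      refine Finset.sum_le_sum fun z hz => ?_
      have h1 := hclose z hz c hc c' hc'
      simp only [happ z hz c c'] at h1
      have h2 := Real.log_le_log ((M.placeAbs w).pos (hpα z hz)) h1
      rw [Real.log_mul (by positivity) (by have := hM z; positivity),
        Real.log_mul (Real.exp_ne_zero _) (pow_ne_zero _ (hM z).ne'), Real.log_exp, Real.log_pow,
        Real.log_pow, ← Real.posLog_eq_log_max_one (by positivity)] at h2
      linarith
    · rw [if_neg hw, add_zero, ← nsmul_eq_mul (conjugates α).card, ← Finset.sum_const, ← Finset.sum_add_distrib]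
      refine Finset.sum_le_sum fun z hz => ?_
      have h2 := Real.log_le_log ((M.placeAbs w).pos (hpα z hz)) (hval w c c' z)
      rwa [Real.log_mul (Real.exp_ne_zero _) (pow_ne_zero _ (hM z).ne'), Real.log_exp,
        Real.log_pow, ← Real.posLog_eq_log_max_one (by positivity)] at h2
  have f1 := M.support_sum_finite (s := conjugates α)
    (f := fun z w => Real.log (M.placeAbs w (aeval z p)))
    fun z _ => M.support_log_placeAbs (aeval z p)
  have f2 : (fun w => if w = v then (conjugates α).card * (T * -Real.log ρ) else
      0).support.Finite := (Set.finite_singleton v).subset fun w hw => by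
    by_contra h
    exact hw (if_neg h)
  have f3 : (fun w => ((conjugates α).card : ℝ) * lx w).support.Finite :=
    hlxfin.subset fun w hw => right_ne_zero_of_mul hw
  have f4' : ∀ z ∈ conjugates α,
      (fun w => (m : ℝ) * Real.posLog (M.placeAbs w z)).support.Finite := fun z _ =>
    (M.support_posLog_placeAbs z).subset fun w hw => right_ne_zero_of_mul hw
  have f4 := M.support_sum_finite f4'
  have key := M.wsum_mono ((f1.union f2).subset (Function.support_add _ _))
    ((f3.union f4).subset (Function.support_add _ _)) hlocal
  rw [M.wsum_add f1 f2, M.wsum_add f3 f4, M.wsum_sum_log_aeval_conjugates α hpα, wsum_single,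
    M.wsum_sum _ f4', wsum_const_mul, zero_add] at key
  simp only [wsum_const_mul] at key
  rw [← Finset.mul_sum] at key
  have hh := sum_conjugates_eq α M.localHeightSum
  rw [← height_eq_conjAvg] at hh
  simp only [localHeightSum] at hh
  rw [hh] at key
  have hc0 : (0 : ℝ) < (conjugates α).card := by exact_mod_cast card_conjugates_pos α
  have key2 : M.weight v * (T * -Real.log ρ) ≤ M.wsum lx + m * M.height α := by
    refine le_of_mul_le_mul_left ?_ hc0
    linarith
  have hTc : (T : ℝ) = s * (m + 1) := by rw [hT]; push_cast; ring
  -- The right side is at most `M.wsum lx` + m·B, so m + 1 ≤ `M.wsum lx` ≤ d₀ remains.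
  have h5 : ((m : ℝ) + 1) * (B + 1) ≤ M.weight v * (T * -Real.log ρ) := by
    rw [hTc]
    have := mul_le_mul_of_nonneg_left hs (by positivity : (0 : ℝ) ≤ m + 1)
    linarith
  have h6 : (m : ℝ) * M.height α ≤ m * B := by gcongr
  rw [hm]
  have : ((m + 1 : ℕ) : ℝ) ≤ d₀ := by push_cast; nlinarith
  exact_mod_cast this

end ProductFormula

/-! ### Trivial places, the bound on conjugates, and the conclusion. -/

theorem exists_nat_forall_le_of_mul_le_log {ε : ℝ} (hε : 0 < ε) (A B : ℝ) :
    ∃ n₀ : ℕ, ∀ n : ℕ, ε * n ≤ A * Real.log n + B → n ≤ n₀ := by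
  have h1 : (fun x : ℝ => A * Real.log x + B) =o[atTop] (fun x : ℝ => x) :=
    (Real.isLittleO_log_id_atTop.const_mul_left A).add
      (Asymptotics.isLittleO_const_id_atTop B)
  have h2 := (h1.comp_tendsto tendsto_natCast_atTop_atTop).def (half_pos hε)
  obtain ⟨n₀, hn₀⟩ := eventually_atTop.mp h2
  refine ⟨n₀, fun n hn => ?_⟩
  by_contra! hlt
  have h3 := hn₀ n hlt.le
  simp only [Function.comp_apply, Real.norm_eq_abs, Nat.abs_cast] at h3
  have h4 := (le_abs_self _).trans h3
  have h5 : (0 : ℝ) < n := by exact_mod_cast (Nat.zero_le _).trans_lt hlt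
  nlinarith

/-- For a trivial valuation the maximal ideal is zero, so relations between residues lift to
relations between elements. -/
theorem linearIndependent_residue_of_trivial (k : Type*) {F : Type*} [Field k] [Field F]
    [Algebra k F] (w : Valuation F ℝ≥0) (hw : ∀ x, x ≠ 0 → w x = 1) {ι : Type*} [Fintype ι]
    (x : ι → w.valuationSubring) (hx : LinearIndependent k (fun i => (x i : F))) :
    LinearIndependent (IsLocalRing.ResidueField (w.comap (algebraMap k F)).valuationSubring)
      (fun i => IsLocalRing.residue w.valuationSubring (x i)) := by
  rw [Fintype.linearIndependent_iff]
  intro g hg i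
  choose r hr using fun i => IsLocalRing.residue_surjective (g i)
  have h1 : IsLocalRing.residue w.valuationSubring
      (∑ i, algebraMap _ w.valuationSubring (r i) * x i) = 0 := by
    rw [← hg, map_sum]
    refine Finset.sum_congr rfl fun i _ => ?_
    rw [← hr, Algebra.smul_def, map_mul,
      Valuation.HasExtension.algebraMap_residue_eq_residue_algebraMap]
  rw [IsLocalRing.residue_eq_zero_iff, Valuation.mem_maximalIdeal_iff] at h1
  have h2 : ((∑ i, algebraMap _ w.valuationSubring (r i) * x i : w.valuationSubring) : F) = 0 := by
    by_contra hne
    exact h1.ne (hw _ hne)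
  have h3 := Fintype.linearIndependent_iff.mp hx (fun i => (r i : k)) (by
    rw [← h2]
    push_cast
    refine Finset.sum_congr rfl fun i _ => ?_
    rw [Algebra.smul_def, Valuation.HasExtension.coe_algebraMap_valuationSubring_eq]) i
  have h4 : r i = 0 := Subtype.ext h3
  rw [← hr i, h4, map_zero]

theorem le_residueDegree_of_trivial (k : Type*) {F : Type*} [Field k] [Field F]
    [Algebra k F] [FiniteDimensional k F] (w : Valuation F ℝ≥0) (hw : ∀ x, x ≠ 0 → w x = 1)
    {ι : Type*} [Fintype ι] (x : ι → F) (hx : LinearIndependent k x) :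
    Fintype.card ι ≤ residueDegree k w := by
  have := finite_residueField_extension k w
  have hle : ∀ i, x i ∈ w.valuationSubring := fun i => by
    rw [Valuation.mem_valuationSubring_iff, hw _ (hx.ne_zero i)]
  exact (linearIndependent_residue_of_trivial k w hw
    (fun i => ⟨x i, hle i⟩) hx).fintype_card_le_finrank

namespace ProductFormula

variable {K : Type*} [Field K] (M : ProductFormula K)

theorem algebraMap_compl_surjective {v : M.Place} (hv : ¬ (M.absVal v).IsNontrivial) :
    Function.Surjective (algebraMap K (M.Compl v)) := by
  intro x
  obtain ⟨a, ha⟩ := (M.denseRange_algebraMap_compl v).exists_dist_lt x one_pos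
  refine ⟨a, ?_⟩
  rw [dist_eq_norm] at ha
  rcases M.norm_compl_of_not_isNontrivial hv (x - algebraMap K _ a) with h | h
  · exact (sub_eq_zero.mp h.1).symm
  · exact absurd h ha.ne

/-- Here K_v = K and w is trivial on F, because a positive power of each nonzero value lies in the
trivial value group of K_v. The residue degree then bounds the number of independent powers of α. -/
theorem natDegree_le_of_not_isNontrivial {v : M.Place} (hv : ¬ (M.absVal v).IsNontrivial)
    {e f : ℕ} {α : AlgebraicClosure K} (hα : M.IsTotallyAdicElement v e f α) :
    (minpoly K α).natDegree ≤ f := by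
  classical
  obtain ⟨F, hF, hσF, w, hw, -, hwf⟩ := hα
    ((M.embed v).comp (IntermediateField.adjoin K {α}).val)
  refine le_trans ?_ hwf
  have hw1 : ∀ x : F, x ≠ 0 → w x = 1 := by
    intro x hx
    obtain ⟨y, hy⟩ := Subgroup.pow_relIndex_mem
      (Units.map (w.comap (algebraMap (M.Compl v) F) : M.Compl v →* ℝ≥0)).range
      (K := (Units.map (w : F →* ℝ≥0)).range) (g := Units.map (w : F →* ℝ≥0) (Units.mk0 x hx))
      ⟨_, rfl⟩
    have hy' : w (algebraMap (M.Compl v) F y) = w x ^ ramificationIndex (M.Compl v) w := by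
      have := congrArg Units.val hy
      simpa using! this
    have hy1 : w (algebraMap (M.Compl v) F y) = 1 := by
      rcases M.norm_compl_of_not_isNontrivial hv (y : M.Compl v) with h | h
      · exact absurd h.1 y.ne_zero
      · rw [← hw] at h
        exact_mod_cast h
    rw [hy1] at hy'
    exact (pow_eq_one_iff_of_nonneg zero_le (ramificationIndex_ne_zero _ w)).mp hy'.symm
  have hα' : α ∈ IntermediateField.adjoin K {α} := IntermediateField.mem_adjoin_simple_self K α
  have hmem : M.embed v α ∈ F := hσF ⟨α, hα'⟩
  have hli : LinearIndependent (M.Compl v)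
      (fun i : Fin (minpoly K α).natDegree => (⟨M.embed v α, hmem⟩ : F) ^ (i : ℕ)) := by
    rw [Fintype.linearIndependent_iff]
    intro g hg
    choose a ha using fun i => M.algebraMap_compl_surjective hv (g i)
    have h3 : M.embed v (∑ i, algebraMap K _ (a i) * α ^ (i : ℕ)) = 0 := by
      have h4 := congrArg F.val hg
      rw [map_sum, map_zero] at h4
      rw [map_sum, ← h4]
      refine Finset.sum_congr rfl fun i _ => ?_
      rw [map_mul, map_pow, AlgHom.commutes, map_smul, map_pow, Algebra.smul_def, ← ha,
        IsScalarTower.algebraMap_apply K (M.Compl v) (M.ComplBar v)]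
      rfl
    have h5 : ∑ i, algebraMap K _ (a i) * α ^ (i : ℕ) = 0 :=
      (map_eq_zero_iff _ (M.embed v).injective).mp h3
    have h6 := Fintype.linearIndependent_iff.mp (linearIndependent_pow (K := K) α) a (by
      rw [← h5]
      exact Finset.sum_congr rfl fun i _ => Algebra.smul_def _ _)
    intro i
    rw [← ha, h6 i, map_zero]
  simpa using le_residueDegree_of_trivial (M.Compl v) w hw1 _ hli

theorem canonicalHeight_nonneg {φ : K[X]} (hd : 2 ≤ φ.natDegree) (α : AlgebraicClosure K) :
    0 ≤ M.canonicalHeight φ α := by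
  obtain ⟨C, -, hC⟩ := M.exists_bound_canonicalHeight hd
  exact ge_of_tendsto' (hC α).1 fun n => div_nonneg (M.height_nonneg _) (by positivity)

theorem archWeight_nonneg : 0 ≤ M.archWeight :=
  M.wsum_nonneg fun w => by split_ifs <;> norm_num

/-- Conjugates of totally adic points of small canonical height are bounded in number. -/
theorem exists_card_conjugates_le {v : M.Place} (hv : IsNonarchimedean (M.absVal v)) {N : ℕ}
    {ρ : ℝ} (hρ0 : 0 < ρ) (hρ1 : ρ < 1) {φ : K[X]} (hd : 2 ≤ φ.natDegree)
    (h : M.GoodReduction v φ) :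
    ∃ n₀ : ℕ, ∀ α : AlgebraicClosure K,
      (∀ τ : AlgebraicClosure K ≃ₐ[K] AlgebraicClosure K,
        HasValueGap (M.conjAbs v τ) (IntermediateField.adjoin K {α}) N ρ) →
      M.canonicalHeight φ α < M.weight v * -Real.log ρ / (24 * (N.factorial + 1 : ℕ)) →
      (conjugates α).card ≤ n₀ := by
  obtain ⟨C, hC0, hC⟩ := M.exists_bound_canonicalHeight hd
  have hlogρ : 0 < -Real.log ρ := by
    have := Real.log_neg hρ0 hρ1
    linarith
  set D : ℝ := ((N.factorial + 1 : ℕ) : ℝ) with hD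
  have hD0 : 1 ≤ D := by rw [hD]; exact_mod_cast Nat.le_add_left 1 _
  set g := M.weight v * -Real.log ρ with hg
  have hg0 : 0 < g := mul_pos (M.weight_pos v) hlogρ
  set d := φ.natDegree with hdd
  have hlog2 : 0 < Real.log 2 := Real.log_pos one_lt_two
  -- The gain has n²-coefficient g/(6D) and the height costs at most 2·g/(24D); the difference
  -- g/(12D) is left against terms of order n log n.
  obtain ⟨n₀, hn₀⟩ := exists_nat_forall_le_of_mul_le_log (ε := g / (12 * D)) (by positivity)
    (M.archWeight + C * d / Real.log 2) (C * d + g * (1 / (2 * D) + 1))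
  refine ⟨n₀, fun α hgap hα => hn₀ _ ?_⟩
  have hlt := hα
  set H := M.canonicalHeight φ α with hH
  have hH0 : 0 ≤ H := M.canonicalHeight_nonneg hd α
  have hmain := M.weight_mul_gain_le hv hd h α
    (M.log_conjVandermonde_add_gain_le hv hρ0 hρ1 hgap)
  set n := (conjugates α).card with hn
  have hn1 : 1 ≤ n := card_conjugates_pos α
  have hn1' : (1 : ℝ) ≤ n := by exact_mod_cast hn1
  have hfac : Real.log n.factorial ≤ n * Real.log n := by
    rw [← Real.log_pow]
    refine Real.log_le_log (by positivity) ?_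
    exact_mod_cast Nat.factorial_le_pow n
  have hlog : ((Nat.log 2 (n - 1) : ℕ) : ℝ) ≤ Real.log n / Real.log 2 := by
    calc ((Nat.log 2 (n - 1) : ℕ) : ℝ) ≤ (Nat.log 2 n : ℕ) := by
          exact_mod_cast Nat.log_mono_right (Nat.sub_le n 1)
      _ ≤ Real.logb 2 n := by exact_mod_cast Real.natLog_le_logb n 2
      _ = _ := rfl
  have hsum : ∑ k ∈ Finset.range (Nat.log d (n - 1) + 1),
      (maxDigit d (n - 1) k : ℝ) * M.height ((polyMap φ)^[k] α) ≤
      2 * n * H + C * (d * (Real.log n / Real.log 2 + 1)) := by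
    have h1 : ∑ k ∈ Finset.range (Nat.log d (n - 1) + 1), (maxDigit d (n - 1) k : ℝ) * d ^ k ≤
        2 * n := by
      have := (sum_maxDigit_le (d := d) (m := n - 1) hd).trans
        (Nat.mul_le_mul_left 2 (Nat.sub_le n 1))
      exact_mod_cast this
    have h2 : ∑ k ∈ Finset.range (Nat.log d (n - 1) + 1), (maxDigit d (n - 1) k : ℝ) ≤
        d * (Real.log n / Real.log 2 + 1) := by
      have : ∑ k ∈ Finset.range (Nat.log d (n - 1) + 1), (maxDigit d (n - 1) k : ℝ) ≤
          d * ((Nat.log 2 (n - 1) : ℕ) + 1) := by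
        exact_mod_cast sum_maxDigit_le_log (d := d) (m := n - 1) hd
      exact this.trans (by gcongr)
    calc _ ≤ ∑ k ∈ Finset.range (Nat.log d (n - 1) + 1),
          ((maxDigit d (n - 1) k : ℝ) * d ^ k * H + C * maxDigit d (n - 1) k) := by
          refine Finset.sum_le_sum fun k _ => ?_
          have h3 := (abs_sub_le_iff.mp ((hC α).2 k)).1
          have h4 : (0 : ℝ) ≤ maxDigit d (n - 1) k := by positivity
          have h5 := mul_le_mul_of_nonneg_left (sub_le_iff_le_add.mp h3) h4
          linarith
      _ ≤ _ := by
          rw [Finset.sum_add_distrib, ← Finset.sum_mul, ← Finset.mul_sum]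
          gcongr
  have h1 := hmain.trans (add_le_add
    (mul_le_mul_of_nonneg_right hfac M.archWeight_nonneg)
    (mul_le_mul_of_nonneg_left hsum (by positivity)))
  rw [← mul_assoc, ← hg] at h1
  have hn0 : (0 : ℝ) < n := by linarith
  have h2 : H ≤ g / (24 * D) := hlt.le
  refine le_of_mul_le_mul_left ?_ hn0
  have h3 : n * (2 * n * H) ≤ n * (2 * n * (g / (24 * D))) := by gcongr
  have h4 : g * ((n - 1) * (n - 2) / (6 * D) - n) ≥
      g * (n * n / (6 * D) - n * (1 / (2 * D)) - n) := by
    refine mul_le_mul_of_nonneg_left ?_ hg0.le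
    have : (n : ℝ) * n / (6 * D) - n * (1 / (2 * D)) = (n * n - 3 * n) / (6 * D) := by
      field_simp
      ring
    rw [this]
    gcongr
    nlinarith
  have h5 : g * ((n : ℝ) * n / (6 * D)) = n * (2 * n * (g / (24 * D))) +
      n * (g / (12 * D) * n) := by
    field_simp
    ring
  have h6 : C * d / Real.log 2 * Real.log n = C * d * (Real.log n / Real.log 2) := by ring
  rw [add_mul, h6]
  nlinarith

theorem card_conjugates_eq_natDegree [CharZero K] (α : AlgebraicClosure K) :
    (conjugates α).card = (minpoly K α).natDegree := by
  have hint : IsIntegral K α := Algebra.IsIntegral.isIntegral α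
  have hsep : (minpoly K α).Separable := (minpoly.irreducible hint).separable
  rw [← card_rootSet_eq_natDegree (K := AlgebraicClosure K) hsep (IsAlgClosed.splits _),
    conjugates, Set.Finite.card_toFinset]

/-- Height and canonical height differ by a bounded amount, so Northcott applies once the degree is
bounded. An archimedean place embeds K in ℂ and makes the number of conjugates equal to the degree;
otherwise the pigeonhole bound is used. -/
theorem finite_canonicalHeight_lt (hM : M.Northcott) {v : M.Place}
    (hv : IsNonarchimedean (M.absVal v)) (hv' : (M.absVal v).IsNontrivial) {e f N : ℕ} {ρ : ℝ}
    (hρ0 : 0 < ρ) (hρ1 : ρ < 1)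
    (hgap : ∀ α : AlgebraicClosure K, M.IsTotallyAdicElement v e f α →
      ∀ τ : AlgebraicClosure K ≃ₐ[K] AlgebraicClosure K,
        HasValueGap (M.conjAbs v τ) (IntermediateField.adjoin K {α}) N ρ)
    {φ : K[X]} (hd : 2 ≤ φ.natDegree) (h : M.GoodReduction v φ) :
    {α : AlgebraicClosure K | M.IsTotallyAdicElement v e f α ∧ M.canonicalHeight φ α <
      M.weight v * -Real.log ρ / (24 * (N.factorial + 1 : ℕ))}.Finite := by
  set c := M.weight v * -Real.log ρ / (24 * (N.factorial + 1 : ℕ))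
  obtain ⟨n₀, hn₀⟩ := M.exists_card_conjugates_le hv (N := N) hρ0 hρ1 hd h
  obtain ⟨C, hC0, hC⟩ := M.exists_bound_canonicalHeight hd
  have hheight : ∀ α, M.canonicalHeight φ α < c → M.height α ≤ max 0 (c + C) := by
    intro α hα
    have h1 := (abs_sub_le_iff.mp ((hC α).2 0)).1
    simp only [Function.iterate_zero, id, pow_zero, one_mul] at h1
    exact le_max_of_le_right (by linarith)
  have hdeg : ∃ d₀ : ℕ, ∀ α : AlgebraicClosure K, M.IsTotallyAdicElement v e f α →
      M.canonicalHeight φ α < c → (minpoly K α).natDegree ≤ d₀ := by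
    by_cases hall : ∀ w, IsNonarchimedean (M.absVal w)
    · obtain ⟨d₀, hd₀⟩ := M.exists_natDegree_le hv' hall (N := N) hρ0 hρ1 n₀
        (le_max_left 0 (c + C))
      exact ⟨d₀, fun α hα hlt => hd₀ α (hgap α hα) (hn₀ α (hgap α hα) hlt) (hheight α hlt)⟩
    · push Not at hall
      obtain ⟨w, hw⟩ := hall
      obtain ⟨σ, -⟩ := M.exists_embedding w hw
      have : CharZero K := σ.charZero
      exact ⟨n₀, fun α hα hlt => by
        rw [← card_conjugates_eq_natDegree]
        exact hn₀ α (hgap α hα) hlt⟩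
  obtain ⟨d₀, hd₀⟩ := hdeg
  exact (hM d₀ (max 0 (c + C))).subset fun α hα =>
    ⟨hd₀ α hα.1 hα.2, hheight α hα.2⟩

end ProductFormula

theorem mainTheorem7 {K : Type*} [Field K] (M : ProductFormula K) (hM : M.Northcott)
    (v : M.Place) (hv : IsNonarchimedean (M.absVal v))
    (hlc : LocallyCompactSpace (M.Compl v))
    (e f : ℕ) (he : 0 < e) (hf : 0 < f) :
    ∃ C : ℝ, 0 < C ∧ ∀ φ : Polynomial K, 2 ≤ φ.natDegree → M.GoodReduction v φ →
      {α : AlgebraicClosure K |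
        M.IsTotallyAdicElement v e f α ∧ M.canonicalHeight φ α < C}.Finite ∧
      {α : AlgebraicClosure K |
        M.IsTotallyAdicElement v e f α ∧ ProductFormula.IsPreperiodic φ α}.Finite := by
  suffices hmain : ∃ C : ℝ, 0 < C ∧ ∀ φ : Polynomial K, 2 ≤ φ.natDegree → M.GoodReduction v φ →
      {α : AlgebraicClosure K |
        M.IsTotallyAdicElement v e f α ∧ M.canonicalHeight φ α < C}.Finite by
    obtain ⟨C, hC, h⟩ := hmain
    refine ⟨C, hC, fun φ hd hφ => ⟨h φ hd hφ, (h φ hd hφ).subset fun α hα => ⟨hα.1, ?_⟩⟩⟩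
    rw [M.canonicalHeight_eq_zero_of_isPreperiodic hd hα.2]
    exact hC
  by_cases hv' : (M.absVal v).IsNontrivial
  · obtain ⟨N, ρ, hρ0, hρ1, hgap⟩ := M.exists_hasValueGap hv hv' hlc f he
    have hlog := Real.log_neg hρ0 hρ1
    exact ⟨_, div_pos (mul_pos (M.weight_pos v) (neg_pos.mpr hlog)) (by positivity),
      fun φ hd hφ => M.finite_canonicalHeight_lt hM hv hv' hρ0 hρ1 hgap hd hφ⟩
  -- For trivial v the degree is at most f, so Northcott applies for any constant.
  · refine ⟨1, one_pos, fun φ hd _ => ?_⟩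
    obtain ⟨B, -, hB⟩ := M.exists_bound_canonicalHeight hd
    refine (hM f (1 + B)).subset fun α hα =>
      ⟨M.natDegree_le_of_not_isNontrivial hv' hα.1, ?_⟩
    have h1 := (abs_sub_le_iff.mp ((hB α).2 0)).1
    simp only [Function.iterate_zero, id, pow_zero, one_mul] at h1
    linarith [hα.2]
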